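/- Let $F$ be a quadratically closed field, i.e. every polynomial $X^2+aX+b\in F[X]$ has a root in $F$. Let $V$ be a finite-dimensional $F$-vector space and let $f,g:V\times V\to F$ be non-degenerate bilinear forms. The asymmetry of $f$ is the unique $\sigma\in\mathrm{GL}(V)$ with $f(v,u)=f(u,\sigma v)$ for all $u,v\in V$; let $\tau$ be the asymmetry of $g$. Assume that $f$ and $g$ are split, i.e. the minimal polynomials of $\sigma$ and $\tau$ split into linear factors over $F$, and that $\sigma$ and $\tau$ are similar. Call $f$ and $g$ equivalent if there is $x\in\mathrm{GL}(V)$ with $g(xu,xv)=f(u,v)$ for all $u,v\in V$. View $V$ as an $F[X]$-module via $\sigma$ (or via $\tau$). (i) If $\mathrm{char}(F)\neq 2$, or if $\mathrm{char}(F)=2$ and no $(X-1)^m$ with $m$ odd is an elementary divisor of $\sigma$, then $f$ and $g$ are equivalent. (ii) Suppose that $\mathrm{char}(F)=2$ and that $(X-1)^m$ is an elementary divisor of $\sigma$ for some odd $m$. Let $V(\sigma)$ and $V(\tau)$ be the generalized $1$-eigenspaces of $\sigma$ and $\tau$. Then, for some $r$, there are an $f$-orthogonal and a $g$-orthogonal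 decomposition $$V(\sigma)=U_1\perp\cdots\perp U_r,\qquad V(\tau)=W_1\perp\cdots\perp W_r,$$ where each $U_m$ (resp. $W_m$) is a (possibly zero) free $F[X]/((X-1)^m)$-module via $\sigma$ (resp. $\tau$). For any such decompositions and every odd $m$ with $1\le m\le r$, the formulas $$f_m(u+(\sigma-1)U_m,\,v+(\sigma-1)U_m)=f((\sigma-1)^{m-1}u,v),\qquad u,v\in U_m,$$ $$g_m(u+(\tau-1)W_m,\,v+(\tau-1)W_m)=g((\tau-1)^{m-1}u,v),\qquad u,v\in W_m,$$ give well-defined non-degenerate symmetric bilinear forms on $U_m/(\sigma-1)U_m$ and $W_m/(\tau-1)W_m$. Moreover, $f$ and $g$ are equivalent if and only if, for each odd $m$ with $1\le m\le r$ and $U_m\neq 0$, the forms $f_m$ and $g_m$ are both alternating or both non-alternating. -/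

import Mathlib

open Polynomial

/-- A field is quadratically closed if it has no extension of degree two, i.e. every (monic)
quadratic polynomial `X ^ 2 + a X + b` has a root. (In characteristic two this is stronger than
every element being a square.) -/
def IsQuadraticallyClosed (F : Type*) [Field F] : Prop :=
  ∀ a b : F, ∃ x : F, x ^ 2 + a * x + b = 0

/-- Equivalence of bilinear forms. -/
def FormsEquivalent {F V W : Type*} [Field F] [AddCommGroup V] [Module F V]
    [AddCommGroup W] [Module F W]
    (f : LinearMap.BilinForm F V) (g : LinearMap.BilinForm F W) : Prop :=
  ∃ x : V ≃ₗ[F] W, ∀ u v : V, g (x u) (x v) = f u v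

/-- `σ` is the asymmetry of `f`: `f(v, u) = f(u, σ v)` for all `u, v`. -/
def IsAsymmetry {F V : Type*} [Field F] [AddCommGroup V] [Module F V]
    (f : LinearMap.BilinForm F V) (σ : Module.End F V) : Prop :=
  ∀ u v : V, f v u = f u (σ v)

/-- A non-degenerate form on a finite dimensional space has exactly one asymmetry, and it is
invertible. -/
theorem existsUnique_asymmetry {F V : Type*} [Field F] [AddCommGroup V] [Module F V]
    [FiniteDimensional F V] (f : LinearMap.BilinForm F V) (hf : f.Nondegenerate) :
    ∃! σ : V ≃ₗ[F] V, IsAsymmetry f (σ : V →ₗ[F] V) := by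
  refine ⟨(f.toDual hf).trans (f.flip.toDual hf.flip).symm, ?_, ?_⟩
  · intro u v
    exact (LinearMap.BilinForm.apply_toDual_symm_apply (hB := hf.flip) (f.toDual hf v) u).symm
  · intro τ hτ
    ext v
    apply (f.flip.toDual hf.flip).injective
    ext u
    have h := hτ u v
    simpa [LinearMap.BilinForm.toDual_def, LinearMap.BilinForm.flip_apply] using h.symm

/-- `q` is one of the elementary divisors of `σ`: `V`, viewed as an `F[X]`-module via `σ`, is
isomorphic to a finite direct sum of modules `F[X] / (p i ^ e i)` with `p i` monic irreducible
and `e i ≥ 1`, and `q` is one of the `p i ^ e i`. -/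
def IsElementaryDivisor {F V : Type*} [Field F] [AddCommGroup V] [Module F V]
    (σ : Module.End F V) (q : F[X]) : Prop :=
  ∃ (k : ℕ) (p : Fin k → F[X]) (e : Fin k → ℕ),
    (∀ i, (p i).Monic ∧ Irreducible (p i) ∧ 1 ≤ e i) ∧
    Nonempty (Module.AEval' σ ≃ₗ[F[X]]
      DirectSum (Fin k) (fun i => F[X] ⧸ Ideal.span {p i ^ e i})) ∧
    ∃ i, p i ^ e i = q

/-- `U` is a `σ`-invariant subspace which, as an `F[X]`-module via `σ`, is a (finite rank, possibly
zero) free module over `F[X] / ((X - 1) ^ m)`. -/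
def IsFreeVia {F V : Type*} [Field F] [AddCommGroup V] [Module F V]
    (σ : Module.End F V) (m : ℕ) (U : Submodule F V) : Prop :=
  ∃ (h : ∀ u ∈ U, σ u ∈ U) (k : ℕ),
    Nonempty (Module.AEval' (σ.restrict h) ≃ₗ[F[X]]
      (Fin k → F[X] ⧸ Ideal.span {((X : F[X]) - 1) ^ m}))

theorem IsFreeVia.pow_apply {F V : Type*} [Field F] [AddCommGroup V] [Module F V]
    {σ : Module.End F V} {m : ℕ} {U : Submodule F V} (hU : IsFreeVia σ m U)
    {u : V} (hu : u ∈ U) : ((σ - 1) ^ m) u = 0 := by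
  obtain ⟨h, k, ⟨e⟩⟩ := hU
  have h1 : ((X : F[X]) - 1) ^ m • Module.AEval'.of (σ.restrict h) ⟨u, hu⟩ = 0 := by
    apply e.injective
    rw [map_smul, map_zero]
    funext i
    obtain ⟨q, hq⟩ := Ideal.Quotient.mk_surjective (e (Module.AEval'.of (σ.restrict h) ⟨u, hu⟩) i)
    rw [Pi.smul_apply, ← hq, Pi.zero_apply]
    change Ideal.Quotient.mk _ (((X : F[X]) - 1) ^ m * q) = 0
    rw [Ideal.Quotient.eq_zero_iff_mem]
    exact Ideal.mul_mem_right _ _ (Ideal.subset_span rfl)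
  rw [← Module.AEval.of_aeval_smul] at h1
  have h2 := (Module.AEval'.of (σ.restrict h)).injective (h1.trans (map_zero _).symm)
  have h3 : (aeval (σ.restrict h) (((X : F[X]) - 1) ^ m)) = (σ.restrict h - 1) ^ m := by simp
  rw [h3] at h2
  have h4 : ∀ (n : ℕ) (w : U),
      ((((σ.restrict h - 1) ^ n : Module.End F U) w : U) : V) = ((σ - 1) ^ n) (w : V) := by
    intro n
    induction n with
    | zero => intro w; simp
    | succ n ih => intro w; rw [pow_succ, pow_succ, Module.End.mul_apply, Module.End.mul_apply, ih]; rfl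
  rw [← h4 m ⟨u, hu⟩]
  exact congrArg Subtype.val h2

/-- The subspace `(σ - 1) U`, as a subspace of `U` (for `σ`-invariant `U`). -/
def subOneImage {F V : Type*} [Field F] [AddCommGroup V] [Module F V]
    (σ : Module.End F V) (U : Submodule F V) : Submodule F U :=
  (U.map (σ - 1)).submoduleOf U

/-- The form `(u, v) ↦ f((σ - 1)^(m-1) u, v)` on `U`. -/
def preInducedForm {F V : Type*} [Field F] [AddCommGroup V] [Module F V]
    (f : LinearMap.BilinForm F V) (σ : Module.End F V) (m : ℕ) (U : Submodule F V) :
    LinearMap.BilinForm F U :=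
  f.compl₁₂ (((σ - 1) ^ (m - 1)) ∘ₗ U.subtype) U.subtype

theorem preInducedForm_left {F V : Type*} [Field F] [AddCommGroup V] [Module F V]
    (f : LinearMap.BilinForm F V) {σ : Module.End F V} {m : ℕ} {U : Submodule F V}
    (hU : IsFreeVia σ m U) (a : U) (ha : a ∈ subOneImage σ U) (b : U) :
    preInducedForm f σ m U a b = 0 := by
  obtain ⟨w, hw, hwa⟩ : ∃ w ∈ U, (σ - 1) w = a := ha
  have : ((σ - 1) ^ (m - 1)) (a : V) = 0 := by
    rcases m with _ | m
    · simpa using hU.pow_apply a.2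
    · rw [← hwa, ← Module.End.mul_apply, ← pow_succ]
      exact hU.pow_apply hw
  simp [preInducedForm, this]

theorem preInducedForm_right {F V : Type*} [Field F] [AddCommGroup V] [Module F V]
    {f : LinearMap.BilinForm F V} {σ : Module.End F V} (hσ : IsAsymmetry f σ) {m : ℕ}
    {U : Submodule F V} (hU : IsFreeVia σ m U) (a b : U) (hb : b ∈ subOneImage σ U) :
    preInducedForm f σ m U a b = 0 := by
  obtain ⟨w, hw, hwb⟩ : ∃ w ∈ U, (σ - 1) w = b := hb
  have h0 : (σ - 1) (((σ - 1) ^ (m - 1)) (a : V)) = 0 := by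
    rcases m with _ | m
    · have : (a : V) = 0 := by simpa using hU.pow_apply a.2
      simp [this]
    · rw [← Module.End.mul_apply, ← pow_succ']
      exact hU.pow_apply a.2
  set c := ((σ - 1) ^ (m - 1)) (a : V) with hc
  have h1 : σ c = c := by simpa [sub_eq_zero] using h0
  have h2 : f c (σ w) = f c w := by
    conv_lhs => rw [← h1]
    rw [← hσ (σ c) w, ← hσ w c]
  have h3 : preInducedForm f σ m U a b = f c b := rfl
  rw [h3, ← hwb]
  simp [h2]

/-- The bilinear form `f_m` on `U / (σ - 1) U` given by
`f_m(u + (σ - 1) U, v + (σ - 1) U) = f((σ - 1)^(m-1) u, v)`. -/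
def inducedForm {F V : Type*} [Field F] [AddCommGroup V] [Module F V]
    (f : LinearMap.BilinForm F V) (σ : Module.End F V) (hσ : IsAsymmetry f σ) (m : ℕ)
    (U : Submodule F V) (hU : IsFreeVia σ m U) :
    LinearMap.BilinForm F (U ⧸ subOneImage σ U) :=
  (subOneImage σ U).liftQ
    (LinearMap.flip ((subOneImage σ U).liftQ (preInducedForm f σ m U).flip
      (fun b hb => LinearMap.mem_ker.mpr
        (LinearMap.ext fun a => preInducedForm_right hσ hU a b hb))))
    (fun a ha => LinearMap.mem_ker.mpr (LinearMap.ext fun b => by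
      obtain ⟨b, rfl⟩ := Submodule.mkQ_surjective _ b
      exact preInducedForm_left f hU a ha b))

theorem inducedForm_mk {F V : Type*} [Field F] [AddCommGroup V] [Module F V]
    (f : LinearMap.BilinForm F V) (σ : Module.End F V) (hσ : IsAsymmetry f σ) (m : ℕ)
    (U : Submodule F V) (hU : IsFreeVia σ m U) (u v : U) :
    inducedForm f σ hσ m U hU ((subOneImage σ U).mkQ u) ((subOneImage σ U).mkQ v) =
      f (((σ - 1) ^ (m - 1)) (u : V)) v := rfl

/-- `V(σ) = U_1 ⊥ ⋯ ⊥ U_r`: an `f`-orthogonal decomposition of the generalized 1-eigenspace of `σ`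
in which each `U_m` is a free `F[X] / ((X - 1) ^ m)`-module via `σ`. The summand `U_m` is
`U i` with `m = i + 1`, for `i : Fin r`. -/
structure IsOrthogonalDecomposition {F V : Type*} [Field F] [AddCommGroup V] [Module F V]
    (f : LinearMap.BilinForm F V) (σ : Module.End F V) (r : ℕ)
    (U : Fin r → Submodule F V) : Prop where
  independent : iSupIndep U
  iSup_eq : iSup U = Module.End.maxGenEigenspace σ 1
  orthogonal : ∀ i j : Fin r, i ≠ j → ∀ u ∈ U i, ∀ v ∈ U j, f u v = 0
  free : ∀ i : Fin r, IsFreeVia σ (i + 1) (U i)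

/-! ### Orthogonal sums and equivalence of bilinear forms. -/

section Forms

variable {F V W : Type*} [Field F] [AddCommGroup V] [Module F V] [AddCommGroup W] [Module F W]

/-! Transporting g along a conjugating map, one may assume that f and g have the same asymmetry σ
(`formsEquivalent_of_isConj`). As f(σx, σy) = f(x, y), generalized eigenspaces for a and b are
orthogonal unless ab = 1. The eigenvalues with c² ≠ 1 fall into pairs {c, c⁻¹} and give two
complementary totally isotropic subspaces; there the form has no invariant beyond σ
(`IsAsymmetry.formsEquivalent_of_no_eigenvalue`). What remains is c = ±1, where N = cσ - 1 is
nilpotent and f(v, u) = c f(u, v + Nv); this is `IsTwisted`.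

For nilpotent N the adjoint of N is -N(1 + N)⁻¹. Hence the numbers f(N^l e_a, e_b) determine f on
the F[N]-span of the vectors e_a. If N^n is the last nonzero power, the form h = f(N^n ·, ·) is
ε(-1)^n-symmetric, and a family with nondegenerate Gram matrix for h spans a nondegenerate free
summand. If h is alternating, a hyperbolic pair of generators can be normalized completely.
Otherwise generators u for f and u' for g can be chosen with the same numbers f(N^l u, u). Both
normalizations proceed degree by degree, each step solving a quadratic equation with nonzero linear
coefficient. The resulting equivalent summands are split off, and `IsTwisted.formsEquivalent`
follows by induction on the dimension. In characteristic two it must also be known whether f(N^n ·,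
·) is alternating on ker N^(n+1) for each n (`IsAltAt`); the choice of u by `IsSplitter` keeps this
information equal on the two complements.

In characteristic two `IsAltAt` holds automatically for odd n, and also when there is no Jordan
block of size n + 1 (`HasNoBlock.isAltAt`). For the other n it says that the induced form on the
summand of block size n + 1 is alternating (`isAlt_inducedForm_iff`), which gives both parts of the
theorem. -/

theorem nondegenerate_of_left [FiniteDimensional F V] {f : LinearMap.BilinForm F V}
    (h : ∀ x, (∀ y, f x y = 0) → x = 0) : f.Nondegenerate :=
  LinearMap.BilinForm.Nondegenerate.ofSeparatingLeft h

theorem FormsEquivalent.of_linearMap [FiniteDimensional F V] [FiniteDimensional F W]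
    {f : LinearMap.BilinForm F V} {g : LinearMap.BilinForm F W}
    (hf : f.Nondegenerate) (hdim : Module.finrank F V = Module.finrank F W)
    (x : V →ₗ[F] W) (hx : ∀ u v, g (x u) (x v) = f u v) : FormsEquivalent f g := by
  have hinj : Function.Injective x := by
    rw [← LinearMap.ker_eq_bot, LinearMap.ker_eq_bot']
    intro u hu
    refine hf.1 u fun v => ?_
    rw [← hx, hu, map_zero, LinearMap.zero_apply]
  exact ⟨LinearEquiv.ofInjectiveOfFinrankEq x hinj hdim, fun u v => hx u v⟩

theorem FormsEquivalent.symm {f : LinearMap.BilinForm F V} {g : LinearMap.BilinForm F W}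
    (h : FormsEquivalent f g) : FormsEquivalent g f := by
  obtain ⟨x, hx⟩ := h
  exact ⟨x.symm, fun u v => by rw [← hx]; simp⟩

/-- Two forms are equivalent if they are pulled back to the same form along linear maps onto
their spaces. -/
theorem FormsEquivalent.of_surjective {E : Type*} [AddCommGroup E] [Module F E]
    {f : LinearMap.BilinForm F V} {g : LinearMap.BilinForm F W}
    (hf : f.Nondegenerate) (hg : g.Nondegenerate)
    (a : E →ₗ[F] V) (b : E →ₗ[F] W) (ha : Function.Surjective a) (hb : Function.Surjective b)
    (h : ∀ x y, f (a x) (a y) = g (b x) (b y)) :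
    ∃ x : V ≃ₗ[F] W, (∀ u v : V, g (x u) (x v) = f u v) ∧ ∀ e, x (a e) = b e := by
  -- Both kernels are the radical of the common pulled-back form, because f and g are
  -- non-degenerate.
  have hker : LinearMap.ker a = LinearMap.ker b := by
    ext e
    simp only [LinearMap.mem_ker]
    constructor
    · intro he
      refine hg.1 _ fun w => ?_
      obtain ⟨e', rfl⟩ := hb w
      rw [← h, he, map_zero, LinearMap.zero_apply]
    · intro he
      refine hf.1 _ fun w => ?_
      obtain ⟨e', rfl⟩ := ha w
      rw [h, he, map_zero, LinearMap.zero_apply]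
  let x : V ≃ₗ[F] W := (a.quotKerEquivOfSurjective ha).symm ≪≫ₗ
    Submodule.quotEquivOfEq _ _ hker ≪≫ₗ b.quotKerEquivOfSurjective hb
  have hx : ∀ e, x (a e) = b e := by
    intro e
    have h1 : (a.quotKerEquivOfSurjective ha).symm (a e) = Submodule.Quotient.mk e := by
      rw [LinearEquiv.symm_apply_eq]
      rfl
    simp only [x, LinearEquiv.trans_apply, h1]
    rfl
  refine ⟨x, fun u v => ?_, hx⟩
  obtain ⟨e, rfl⟩ := ha u
  obtain ⟨e', rfl⟩ := ha v
  rw [hx, hx, h]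

theorem disjoint_of_orthogonal {f : LinearMap.BilinForm F V} (hf : f.Nondegenerate)
    {K R : Submodule F V} (hsup : K ⊔ R = ⊤)
    (h1 : ∀ x ∈ K, ∀ y ∈ R, f x y = 0) (h2 : ∀ x ∈ R, ∀ y ∈ K, f x y = 0) : IsCompl K R := by
  refine ⟨Submodule.disjoint_def.mpr fun x hxK hxR => hf.1 x fun y => ?_,
    codisjoint_iff.mpr hsup⟩
  obtain ⟨k, hk, r, hr, rfl⟩ := Submodule.mem_sup.mp (hsup ▸ Submodule.mem_top : y ∈ K ⊔ R)
  rw [map_add, h2 x hxR k hk, h1 x hxK r hr, add_zero]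

theorem restrict_nondegenerate_of_orthogonal [FiniteDimensional F V]
    {f : LinearMap.BilinForm F V} (hf : f.Nondegenerate)
    {K R : Submodule F V} (hsup : K ⊔ R = ⊤)
    (h1 : ∀ x ∈ K, ∀ y ∈ R, f x y = 0) : (f.restrict K).Nondegenerate := by
  refine nondegenerate_of_left fun x hx => Subtype.ext (hf.1 _ fun y => ?_)
  obtain ⟨k, hk, r, hr, rfl⟩ := Submodule.mem_sup.mp (hsup ▸ Submodule.mem_top : y ∈ K ⊔ R)
  rw [map_add, h1 x x.2 r hr, add_zero]
  exact hx ⟨k, hk⟩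

theorem FormsEquivalent.of_orthogonal
    {f : LinearMap.BilinForm F V} {g : LinearMap.BilinForm F W}
    {K R : Submodule F V} {K' R' : Submodule F W} (hc : IsCompl K R) (hc' : IsCompl K' R')
    (h1 : ∀ x ∈ K, ∀ y ∈ R, f x y = 0) (h2 : ∀ x ∈ R, ∀ y ∈ K, f x y = 0)
    (h1' : ∀ x ∈ K', ∀ y ∈ R', g x y = 0) (h2' : ∀ x ∈ R', ∀ y ∈ K', g x y = 0)
    (hK : FormsEquivalent (f.restrict K) (g.restrict K'))
    (hR : FormsEquivalent (f.restrict R) (g.restrict R')) : FormsEquivalent f g := by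
  obtain ⟨x, hx⟩ := hK
  obtain ⟨y, hy⟩ := hR
  have hx' : ∀ a b : K, g (x a) (x b) = f a b := hx
  have hy' : ∀ a b : R, g (y a) (y b) = f a b := hy
  refine ⟨(K.prodEquivOfIsCompl R hc).symm ≪≫ₗ (x.prodCongr y) ≪≫ₗ
    K'.prodEquivOfIsCompl R' hc', fun u v => ?_⟩
  obtain ⟨⟨a, b⟩, rfl⟩ := (K.prodEquivOfIsCompl R hc).surjective u
  obtain ⟨⟨c, d⟩, rfl⟩ := (K.prodEquivOfIsCompl R hc).surjective v
  simp [hx', hy', h1 a a.2 d d.2, h2 b b.2 c c.2, h1' (x a) (x a).2 (y d) (y d).2,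
    h2' (y b) (y b).2 (x c) (x c).2]

/-- The vectors `y` with `f(x, y) = 0` for all `x ∈ U`. -/
def rightOrthogonal (f : LinearMap.BilinForm F V) (U : Submodule F V) : Submodule F V :=
  f.orthogonal U

theorem mem_rightOrthogonal {f : LinearMap.BilinForm F V} {U : Submodule F V} {y : V} :
    y ∈ rightOrthogonal f U ↔ ∀ x ∈ U, f x y = 0 :=
  LinearMap.BilinForm.mem_orthogonal_iff

/-- The functional f(·, y) on U is represented by some a in U, and y - a is then orthogonal to U. -/
theorem sup_rightOrthogonal {f : LinearMap.BilinForm F V} {U : Submodule F V}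
    [FiniteDimensional F U] (hU : (f.restrict U).Nondegenerate) :
    U ⊔ rightOrthogonal f U = ⊤ := by
  rw [eq_top_iff]
  intro y _
  let a := ((f.restrict U).flip.toDual hU.flip).symm ((f.flip y).comp U.subtype)
  have ha : ∀ x : U, f x a = f x y := fun x =>
    LinearMap.BilinForm.apply_toDual_symm_apply (hB := hU.flip) ((f.flip y).comp U.subtype) x
  rw [Submodule.mem_sup]
  refine ⟨a, a.2, y - a, mem_rightOrthogonal.mpr fun x hx => ?_, by abel⟩
  rw [map_sub, ← ha ⟨x, hx⟩, sub_self]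

theorem coe_restrict_pow {N : Module.End F V} {U : Submodule F V} (h : ∀ u ∈ U, N u ∈ U)
    (n : ℕ) (u : U) : (((N.restrict h) ^ n) u : V) = (N ^ n) u := by
  induction n generalizing u with
  | zero => simp
  | succ n ih => rw [pow_succ, pow_succ, Module.End.mul_apply, Module.End.mul_apply, ih]; rfl

theorem pow_mem_of_invariant {N : Module.End F V} {U : Submodule F V} (h : ∀ u ∈ U, N u ∈ U)
    (n : ℕ) {u : V} (hu : u ∈ U) : (N ^ n) u ∈ U := by
  rw [← coe_restrict_pow h n ⟨u, hu⟩]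
  exact Subtype.prop _

/-- The dimensions of the kernels of the powers record the Jordan type; additivity passes equality
of types to complements. -/
theorem finrank_ker_pow_add [FiniteDimensional F V] {N : Module.End F V} {U R : Submodule F V}
    (hc : IsCompl U R) (hU : ∀ u ∈ U, N u ∈ U) (hR : ∀ u ∈ R, N u ∈ R) (j : ℕ) :
    Module.finrank F (LinearMap.ker (N ^ j)) =
      Module.finrank F (LinearMap.ker ((N.restrict hU) ^ j)) +
      Module.finrank F (LinearMap.ker ((N.restrict hR) ^ j)) := by
  have key : (LinearMap.ker (((N.restrict hU) ^ j).prodMap ((N.restrict hR) ^ j))).map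
      (U.prodEquivOfIsCompl R hc : (U × R) →ₗ[F] V) = LinearMap.ker (N ^ j) := by
    ext v
    simp only [Submodule.mem_map, LinearMap.mem_ker]
    constructor
    · rintro ⟨⟨a, b⟩, hab, rfl⟩
      simp only [LinearMap.prodMap_apply, Prod.mk_eq_zero] at hab
      simp [← coe_restrict_pow hU, ← coe_restrict_pow hR, hab.1, hab.2]
    · intro hv
      obtain ⟨⟨a, b⟩, rfl⟩ := (U.prodEquivOfIsCompl R hc).surjective v
      refine ⟨⟨a, b⟩, ?_, rfl⟩
      apply (U.prodEquivOfIsCompl R hc).injective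
      rw [map_zero, ← hv]
      simp [← coe_restrict_pow hU, ← coe_restrict_pow hR]
  rw [← key, LinearEquiv.finrank_map_eq, LinearMap.ker_prodMap,
    ← Module.finrank_prod]
  exact LinearEquiv.finrank_eq
    { toFun := fun x => (⟨x.1.1, x.2.1⟩, ⟨x.1.2, x.2.2⟩)
      invFun := fun y => ⟨(y.1, y.2), y.1.2, y.2.2⟩
      map_add' := fun _ _ => rfl
      map_smul' := fun _ _ => rfl
      left_inv := fun _ => rfl
      right_inv := fun _ => rfl }

end Forms

/-! ### Moving powers of N across a twisted form. -/

section Twisted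

variable {F V : Type*} [Field F] [AddCommGroup V] [Module F V]

/-- `f(v, u) = ε f(u, v + N v)`, i.e. `ε (1 + N)` is the asymmetry of `f`. -/
def IsTwisted (f : LinearMap.BilinForm F V) (ε : F) (N : Module.End F V) : Prop :=
  ∀ u v, f v u = ε * (f u v + f u (N v))

variable {f : LinearMap.BilinForm F V} {ε : F} {N : Module.End F V}

theorem IsTwisted.restrict (hf : IsTwisted f ε N) {U : Submodule F V} (h : ∀ u ∈ U, N u ∈ U) :
    IsTwisted (f.restrict U) ε (N.restrict h) := fun u v => hf u v

/-- Exchanging the arguments twice must return f(x, y). The relation reads f((1 + N)x, Ny) = -f(Nx,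
y), so for nilpotent N the adjoint of N is -N(1 + N)⁻¹. -/
theorem IsTwisted.adjoint (hf : IsTwisted f ε N) (hε : ε * ε = 1) (x y : V) :
    f (N x) y + f x (N y) + f (N x) (N y) = 0 := by
  have h1 := hf y x
  have h2 : f y x = ε * (f x y + f x (N y)) := hf x y
  have h3 : f y (N x) = ε * (f (N x) y + f (N x) (N y)) := hf (N x) y
  rw [h2, h3] at h1
  linear_combination -h1 - (f x y + f x (N y) + f (N x) y + f (N x) (N y)) * hε

theorem IsTwisted.apply_pow_succ (hf : IsTwisted f ε N) (hε : ε * ε = 1) (i k : ℕ) (x y : V) :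
    f ((N ^ i) x) ((N ^ (k + 1)) y) =
      - f ((N ^ (i + 1)) x) ((N ^ k) y) - f ((N ^ (i + 1)) x) ((N ^ (k + 1)) y) := by
  have h := hf.adjoint hε ((N ^ i) x) ((N ^ k) y)
  rw [← Module.End.mul_apply, ← Module.End.mul_apply, ← pow_succ', ← pow_succ'] at h
  linear_combination h

theorem pow_apply_eq_zero_of_le {m l : ℕ} {x : V} (hx : (N ^ m) x = 0) (h : m ≤ l) :
    (N ^ l) x = 0 := by
  obtain ⟨d, rfl⟩ := Nat.exists_eq_add_of_le' h
  rw [pow_add, Module.End.mul_apply, hx, map_zero]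

/-- If `f(N^l u, v) = 0` for all `l ≥ j` then `f(N^a u, N^b v) = 0` for `a + b ≥ j`. -/
theorem IsTwisted.apply_pow_pow_eq_zero (hf : IsTwisted f ε N) (hε : ε * ε = 1) {m : ℕ}
    {u v : V} (hN : (N ^ m) u = 0) {j : ℕ} (h : ∀ l, j ≤ l → f ((N ^ l) u) v = 0) :
    ∀ b a, j ≤ a + b → f ((N ^ a) u) ((N ^ b) v) = 0 := by
  intro b
  induction b with
  | zero => intro a ha; simpa using h a ha
  | succ b ih =>
    intro a ha
    -- Moving one N to the left leaves a term still containing N^(b+1) on the right but with a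
    -- higher power on the left. It is treated by induction on d, which bounds the distance from a
    -- to the exponent m killing u.
    obtain ⟨d, hd⟩ : ∃ d, m ≤ a + d := ⟨m, by omega⟩
    induction d generalizing a with
    | zero => rw [pow_apply_eq_zero_of_le hN (by simpa using hd), map_zero, LinearMap.zero_apply]
    | succ d ihd =>
      rw [hf.apply_pow_succ hε, ih (a + 1) (by omega), ihd (a + 1) (by omega) (by omega)]
      simp

/-- The first two terms of the expansion (-N)^k (1 + N)^(-k) = (-1)^k (N^k - k N^(k+1) + ...). The
second one is needed in characteristic two, where leading terms cancel. -/
theorem IsTwisted.apply_pow_pow (hf : IsTwisted f ε N) (hε : ε * ε = 1) {m : ℕ}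
    {u v : V} (hN : (N ^ m) u = 0) {j : ℕ} (h : ∀ l, j + 1 < l → f ((N ^ l) u) v = 0)
    (k i : ℕ) (hik : i + k = j) :
    f ((N ^ i) u) ((N ^ k) v) =
      (-1) ^ k * (f ((N ^ j) u) v - k * f ((N ^ (j + 1)) u) v) := by
  have key : ∀ k i, i + k = j + 1 →
      f ((N ^ i) u) ((N ^ k) v) = (-1) ^ k * f ((N ^ (j + 1)) u) v := by
    intro k
    induction k with
    | zero => intro i hi; obtain rfl : i = j + 1 := by omega
              simp
    | succ k ih =>
      intro i hi
      rw [hf.apply_pow_succ hε, ih (i + 1) (by omega),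
        hf.apply_pow_pow_eq_zero hε hN (j := j + 2) (fun l hl => h l (by omega)) _ _ (by omega)]
      ring
  induction k generalizing i with
  | zero => obtain rfl : i = j := by omega
            simp
  | succ k ih =>
    rw [hf.apply_pow_succ hε]
    rcases Nat.lt_or_ge j (i + 1 + k) with h' | h'
    · omega
    · rw [ih (i + 1) (by omega), key _ _ (by omega)]
      push_cast
      ring

theorem IsTwisted.apply_pow_pow_top (hf : IsTwisted f ε N) (hε : ε * ε = 1) {m : ℕ}
    {u v : V} (hN : (N ^ m) u = 0) {j : ℕ} (h : ∀ l, j < l → f ((N ^ l) u) v = 0)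
    (k i : ℕ) (hik : i + k = j) :
    f ((N ^ i) u) ((N ^ k) v) = (-1) ^ k * f ((N ^ j) u) v := by
  rw [hf.apply_pow_pow hε hN (fun l hl => h l (by omega)) k i hik, h (j + 1) (by omega)]
  ring

/-- The indices `j` for which `f(N^j z, z)` is determined by the `f(N^l z, z)` with `l > j`. -/
def IsRigid (ε : F) (j : ℕ) : Prop :=
  ((2 : F) ≠ 0 ∧ ε * (-1) ^ j = -1) ∨ ((2 : F) = 0 ∧ Odd j)

theorem eq_one_of_mul_self (h2 : (2 : F) = 0) (hε : ε * ε = 1) : ε = 1 := by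
  have h : (ε - 1) * (ε - 1) = 0 := by linear_combination hε + (1 - ε) * h2
  exact sub_eq_zero.mp (mul_self_eq_zero.mp h)

theorem neg_one_eq_one (h2 : (2 : F) = 0) : (-1 : F) = 1 := by linear_combination -h2

theorem cast_even_of_two_eq_zero (h2 : (2 : F) = 0) {i : ℕ} (hi : Even i) : (i : F) = 0 := by
  obtain ⟨r, rfl⟩ := hi
  push_cast
  linear_combination (r : F) * h2

/-- If ε(-1)^j = -1, the twisted identity in degree j says that the value equals its own negative.
In characteristic two the identity is used in the even degree j - 1: the terms of that degree cancel
and the value in degree j is left over. -/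
theorem IsTwisted.apply_self_eq_zero (hf : IsTwisted f ε N) (hε : ε * ε = 1) {m : ℕ}
    {z : V} (hN : (N ^ m) z = 0) {j : ℕ} (hj : IsRigid ε j)
    (h : ∀ l, j < l → f ((N ^ l) z) z = 0) : f ((N ^ j) z) z = 0 := by
  rcases hj with ⟨h2, hj⟩ | ⟨h2, hj⟩
  · have h0 := hf z ((N ^ j) z)
    rw [← Module.End.mul_apply, ← pow_succ'] at h0
    have h1 := hf.apply_pow_pow_top hε hN h j 0 (by omega)
    have h3 := hf.apply_pow_pow_eq_zero hε hN (j := j + 1) (fun l hl => h l (by omega)) (j + 1) 0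
      (by omega)
    simp only [pow_zero, Module.End.one_apply] at h1 h3
    rw [h1, h3] at h0
    have : (2 : F) * f ((N ^ j) z) z = 0 := by linear_combination h0 + f ((N ^ j) z) z * hj
    exact (mul_eq_zero.mp this).resolve_left h2
  · obtain ⟨i, rfl⟩ : ∃ i, j = i + 1 := ⟨j - 1, by have := hj.pos; omega⟩
    have hi : Even i := by
      rw [Nat.odd_add_one, Nat.not_odd_iff_even] at hj; exact hj
    have h0 := hf z ((N ^ i) z)
    rw [← Module.End.mul_apply, ← pow_succ'] at h0
    have h1 := hf.apply_pow_pow hε hN h i 0 (by omega)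
    have h3 := hf.apply_pow_pow_top hε hN h (i + 1) 0 (by omega)
    simp only [pow_zero, Module.End.one_apply] at h1 h3
    rw [h1, h3, eq_one_of_mul_self h2 hε, neg_one_eq_one h2, cast_even_of_two_eq_zero h2 hi] at h0
    simp only [one_pow, one_mul, zero_mul, sub_zero] at h0
    linear_combination -h0

end Twisted

/-! ### Correcting a vector z until f(N^l z, z) = 0 for all l. -/

section Adjust

variable {F V : Type*} [Field F] [AddCommGroup V] [Module F V]
  {f : LinearMap.BilinForm F V} {ε : F} {N : Module.End F V}

theorem IsQuadraticallyClosed.exists_root (hF : IsQuadraticallyClosed F) (a b c : F)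
    (hb : b ≠ 0) : ∃ x : F, a * x ^ 2 + b * x + c = 0 := by
  by_cases ha : a = 0
  · exact ⟨-c / b, by rw [ha]; field_simp; ring⟩
  · obtain ⟨x, hx⟩ := hF (b / a) (c / a)
    refine ⟨x, ?_⟩
    field_simp at hx
    linear_combination hx

theorem apply_pow_add_smul (x y : V) (c : F) (i : ℕ) :
    f ((N ^ i) (x + c • y)) (x + c • y) =
      f ((N ^ i) x) x + c * (f ((N ^ i) y) x + f ((N ^ i) x) y) + c ^ 2 * f ((N ^ i) y) y := by
  simp only [map_add, map_smul, LinearMap.add_apply, LinearMap.smul_apply, smul_eq_mul]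
  ring

/-- One step of the correction of `z` by multiples of the vectors `N^k v`. -/
theorem IsTwisted.exists_smul_add (hF : IsQuadraticallyClosed F) (hf : IsTwisted f ε N)
    (hε : ε * ε = 1) {n : ℕ} (hN : N ^ (n + 1) = 0) {z v : V}
    (hzv : f ((N ^ n) z) v ≠ 0) {j : ℕ} (hj : j < n) (h : ∀ l, j < l → f ((N ^ l) z) z = 0) :
    ∃ (k : ℕ) (c : F), f ((N ^ n) (z + c • (N ^ k) v)) v ≠ 0 ∧
      ∀ l, j ≤ l → f ((N ^ l) (z + c • (N ^ k) v)) (z + c • (N ^ k) v) = 0 := by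
  have hN0 : ∀ x, (N ^ (n + 1)) x = 0 := fun x => by rw [hN]; rfl
  have hvan : ∀ x y : V, ∀ a b, n + 1 ≤ a + b → f ((N ^ a) x) ((N ^ b) y) = 0 :=
    fun x y a b hab => hf.apply_pow_pow_eq_zero hε (hN0 x) (j := n + 1)
      (fun l hl => by rw [pow_apply_eq_zero_of_le (hN0 x) hl, map_zero, LinearMap.zero_apply]) b a hab
  have hvan' : ∀ x y : V, ∀ a, n < a → f ((N ^ a) x) y = 0 :=
    fun x y a ha => by simpa using hvan x y a 0 (by omega)
  have hpow : ∀ (a b : ℕ) (x : V), (N ^ a) ((N ^ b) x) = (N ^ (a + b)) x := fun a b x => by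
    rw [pow_add, Module.End.mul_apply]
  by_cases hr : IsRigid ε j
  · refine ⟨0, 0, by simpa using hzv, fun l hl => ?_⟩
    rw [zero_smul, add_zero]
    rcases hl.lt_or_eq with hl | rfl
    · exact h l hl
    · exact hf.apply_self_eq_zero hε (hN0 z) hr h
  by_cases h2 : (2 : F) = 0
  · have hje : Even j := by
      rw [← Nat.not_odd_iff_even]
      exact fun ho => hr (Or.inr ⟨h2, ho⟩)
    -- With k = n - j the two cross terms would add up to a multiple of 2. Taking k one smaller,
    -- their leading parts still cancel, but for even j the next-order parts leave exactly f(N^n z,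
    -- v) (`e5`).
    obtain ⟨k, rfl⟩ : ∃ k, n = j + k + 1 := ⟨n - j - 1, by omega⟩
    have hε1 := eq_one_of_mul_self h2 hε
    have hm1 := neg_one_eq_one h2
    have e1 := hf.apply_pow_pow hε (hN0 z) (j := j + k) (fun l hl => hvan' z v l (by omega)) k j rfl
    have e2 := hf.apply_pow_pow hε (hN0 z) (j := j + k) (fun l hl => hvan' z v l (by omega))
      (j + k) 0 (by omega)
    have e3 := hf.apply_pow_pow_top hε (hN0 z) (j := j + k + 1) (fun l hl => hvan' z v l (by omega))
      (j + k + 1) 0 (by omega)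
    have e4 := hf z ((N ^ (j + k)) v)
    rw [← Module.End.mul_apply, ← pow_succ'] at e4
    rw [pow_zero, Module.End.one_apply] at e2 e3
    rw [e2, e3, hε1, hm1] at e4
    rw [hm1] at e1
    have e5 : f ((N ^ (j + k)) v) z + f ((N ^ j) z) ((N ^ k) v) = f ((N ^ (j + k + 1)) z) v := by
      rw [e4, e1]
      have hj0 := cast_even_of_two_eq_zero h2 hje
      push_cast
      rw [hj0]
      simp only [one_pow]
      linear_combination (f ((N ^ (j + k)) z) v - k * f ((N ^ (j + k + 1)) z) v) * h2
    -- This quadratic expresses that the value in degree j vanishes for z + c N^k v.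
    obtain ⟨c, hc⟩ := hF.exists_root (f ((N ^ (j + k)) v) ((N ^ k) v)) _ (f ((N ^ j) z) z) hzv
    refine ⟨k, c, ?_, ?_⟩
    · have : f ((N ^ (j + k + 1)) ((N ^ k) v)) v = 0 := by
        rw [hpow]
        rcases Nat.eq_zero_or_pos k with rfl | hk
        · exact hf.apply_self_eq_zero hε (hN0 v) (Or.inr ⟨h2, by simpa using hje.add_one⟩)
            (fun l hl => hvan' v v l (by omega))
        · exact hvan' v v _ (by omega)
      rw [map_add, map_smul, map_add, map_smul, LinearMap.add_apply, LinearMap.smul_apply, this,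
        smul_zero, add_zero]
      exact hzv
    · have h1 : ∀ l, j + 1 < l → f ((N ^ l) (z + c • (N ^ k) v)) (z + c • (N ^ k) v) = 0 := by
        intro l hl
        rw [apply_pow_add_smul, h l (by omega), hpow, hvan' v z (l + k) (by omega),
          hvan z v l k (by omega), hvan v v (l + k) k (by omega)]
        ring
      -- Since k is one smaller, degree j + 1 is disturbed too; but j + 1 is odd, so its value
      -- vanishes by rigidity.
      have h3 := hf.apply_self_eq_zero hε (hN0 (z + c • (N ^ k) v)) (j := j + 1)
        (Or.inr ⟨h2, hje.add_one⟩) h1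
      intro l hl
      rcases Nat.lt_or_ge (j + 1) l with hl' | hl'
      · exact h1 l hl'
      obtain rfl | rfl : l = j + 1 ∨ l = j := by omega
      · exact h3
      · rw [apply_pow_add_smul, hpow, e5]
        linear_combination hc
  -- Away from characteristic two, non-rigidity means ε(-1)^j = 1, so the cross terms add up to
  -- 2(-1)^k f(N^n z, v). The term in c² has total degree n + k > n and vanishes, leaving a linear
  -- equation.
  · obtain ⟨k, rfl⟩ : ∃ k, n = j + k := ⟨n - j, by omega⟩
    have hεj : ε * (-1) ^ j = 1 := by
      have h1 : (ε * (-1) ^ j) * (ε * (-1) ^ j) = 1 := by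
        have : ((-1 : F) ^ j) * (-1) ^ j = 1 := by rw [← mul_pow]; simp
        linear_combination ε * ε * this + hε
      rcases mul_self_eq_one_iff.mp h1 with h | h
      · exact h
      · exact absurd (Or.inl ⟨h2, h⟩) hr
    have e1 := hf.apply_pow_pow_top hε (hN0 z) (j := j + k) (fun l hl => hvan' z v l (by omega))
      k j rfl
    have e2 := hf.apply_pow_pow_top hε (hN0 z) (j := j + k) (fun l hl => hvan' z v l (by omega))
      (j + k) 0 (by omega)
    have e3 := hvan z v 0 (j + k + 1) (by omega)
    have e4 := hf z ((N ^ (j + k)) v)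
    rw [← Module.End.mul_apply, ← pow_succ'] at e4
    rw [pow_zero, Module.End.one_apply] at e2 e3
    rw [e2, e3] at e4
    have e5 : f ((N ^ (j + k)) v) z + f ((N ^ j) z) ((N ^ k) v) =
        2 * (-1) ^ k * f ((N ^ (j + k)) z) v := by
      rw [e4, e1, pow_add]
      linear_combination (-1) ^ k * f ((N ^ (j + k)) z) v * hεj
    have hne : 2 * (-1) ^ k * f ((N ^ (j + k)) z) v ≠ 0 :=
      mul_ne_zero (mul_ne_zero h2 (pow_ne_zero _ (by simp))) hzv
    refine ⟨k, -f ((N ^ j) z) z / (2 * (-1) ^ k * f ((N ^ (j + k)) z) v), ?_, fun l hl => ?_⟩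
    · have : f ((N ^ (j + k)) ((N ^ k) v)) v = 0 := by
        rw [hpow]; exact hvan' v v _ (by omega)
      rw [map_add, map_smul, map_add, map_smul, LinearMap.add_apply, LinearMap.smul_apply, this,
        smul_zero, add_zero]
      exact hzv
    · rcases hl.lt_or_eq with hl' | rfl
      · rw [apply_pow_add_smul, h l hl', hpow, hvan' v z (l + k) (by omega),
          hvan z v l k (by omega), hvan v v (l + k) k (by omega)]
        ring
      · rw [apply_pow_add_smul, hpow, e5, hvan v v (j + k) k (by omega)]
        field_simp
        ring

/-- If `f(N^n z, v) ≠ 0`, `f(N^n z, z) = 0` and `N^(n+1) = 0`, then `z` can be corrected by an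
element of any `N`-invariant subspace containing `v` so that `f(N^l z, z) = 0` for all `l`. -/
theorem IsTwisted.exists_isotropic (hF : IsQuadraticallyClosed F) (hf : IsTwisted f ε N)
    (hε : ε * ε = 1) {n : ℕ} (hN : N ^ (n + 1) = 0) {Y : Submodule F V}
    (hY : ∀ y ∈ Y, N y ∈ Y) {z v : V} (hv : v ∈ Y)
    (hzv : f ((N ^ n) z) v ≠ 0) (hzz : f ((N ^ n) z) z = 0) :
    ∃ z', z' - z ∈ Y ∧ f ((N ^ n) z') v ≠ 0 ∧ ∀ l, f ((N ^ l) z') z' = 0 := by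
  have main : ∀ t, t ≤ n → ∀ z, f ((N ^ n) z) v ≠ 0 → (∀ l, t ≤ l → f ((N ^ l) z) z = 0) →
      ∃ z', z' - z ∈ Y ∧ f ((N ^ n) z') v ≠ 0 ∧ ∀ l, f ((N ^ l) z') z' = 0 := by
    intro t
    induction t with
    | zero => exact fun _ z h1 h2 => ⟨z, by simp, h1, fun l => h2 l (Nat.zero_le l)⟩
    | succ t ih =>
      intro ht z h1 h2
      obtain ⟨k, c, h3, h4⟩ := hf.exists_smul_add hF hε hN h1 (j := t) (by omega)
        (fun l hl => h2 l hl)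
      obtain ⟨z', h5, h6⟩ := ih (by omega) _ h3 h4
      refine ⟨z', ?_, h6⟩
      have : z' - z = (z' - (z + c • (N ^ k) v)) + c • (N ^ k) v := by abel
      rw [this]
      exact Y.add_mem h5 (Y.smul_mem _ (pow_mem_of_invariant hY k hv))
  refine main n le_rfl z hzv fun l hl => ?_
  rcases hl.lt_or_eq with hl | rfl
  · have : (N ^ l) z = 0 := pow_apply_eq_zero_of_le (by rw [hN]; rfl : (N ^ (n + 1)) z = 0) hl
    rw [this, map_zero, LinearMap.zero_apply]
  · exact hzz

end Adjust

/-! ### Orthogonal complements of N-invariant subspaces. -/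

section Complement

variable {F V : Type*} [Field F] [AddCommGroup V] [Module F V]
  {f : LinearMap.BilinForm F V} {ε : F} {N : Module.End F V}

/-- The geometric series for (1 + N)⁻¹, which terminates at the power killing x. -/
theorem exists_eq_add_apply {U : Submodule F V} (hU : ∀ u ∈ U, N u ∈ U) (m : ℕ) :
    ∀ x ∈ U, (N ^ m) x = 0 → ∃ y ∈ U, x = y + N y := by
  induction m with
  | zero => exact fun x _ h0 => ⟨0, U.zero_mem, by simpa using h0⟩
  | succ m ih =>
    intro x hx h0
    obtain ⟨y, hy, h⟩ := ih (-N x) (U.neg_mem (hU x hx)) (by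
      rw [map_neg, ← Module.End.mul_apply, ← pow_succ, h0, neg_zero])
    exact ⟨x + y, U.add_mem hx hy, by
      rw [map_add, add_assoc, add_left_comm y, ← h]; abel⟩

/-- The adjoint relation gives f(Nx, (1 + N)w) = -f(x, Nw), and 1 + N maps U onto U. -/
theorem IsTwisted.apply_left_eq_zero (hf : IsTwisted f ε N) (hε : ε * ε = 1)
    (hN : IsNilpotent N) {U : Submodule F V} (hU : ∀ u ∈ U, N u ∈ U) {x : V}
    (hx : ∀ y ∈ U, f x y = 0) : ∀ y ∈ U, f (N x) y = 0 := by
  intro y hy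
  obtain ⟨m, hm⟩ := hN
  obtain ⟨w, hw, rfl⟩ := exists_eq_add_apply hU m y hy (by rw [hm]; rfl)
  have := hf.adjoint hε x w
  rw [hx _ (hU w hw)] at this
  rw [map_add]
  linear_combination this

theorem IsTwisted.pow_apply_left_eq_zero (hf : IsTwisted f ε N) (hε : ε * ε = 1)
    (hN : IsNilpotent N) {U : Submodule F V} (hU : ∀ u ∈ U, N u ∈ U) {x : V}
    (hx : ∀ y ∈ U, f x y = 0) (k : ℕ) : ∀ y ∈ U, f ((N ^ k) x) y = 0 := by
  induction k with
  | zero => simpa using hx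
  | succ k ih =>
    rw [pow_succ', Module.End.mul_apply]
    exact hf.apply_left_eq_zero hε hN hU ih

theorem IsTwisted.rightOrthogonal_invariant (hf : IsTwisted f ε N) (hε : ε * ε = 1)
    (hN : IsNilpotent N) {U : Submodule F V} (hU : ∀ u ∈ U, N u ∈ U) :
    ∀ y ∈ rightOrthogonal f U, N y ∈ rightOrthogonal f U := by
  intro y hy
  rw [mem_rightOrthogonal] at hy ⊢
  intro x hx
  obtain ⟨m, hm⟩ := hN
  obtain ⟨w, hw, rfl⟩ := exists_eq_add_apply hU m x hx (by rw [hm]; rfl)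
  have := hf.adjoint hε w y
  rw [hy _ (hU w hw)] at this
  rw [map_add, LinearMap.add_apply]
  linear_combination this

theorem IsTwisted.apply_rightOrthogonal (hf : IsTwisted f ε N) (hε : ε * ε = 1)
    (hN : IsNilpotent N) {U : Submodule F V} (hU : ∀ u ∈ U, N u ∈ U) :
    ∀ y ∈ rightOrthogonal f U, ∀ x ∈ U, f y x = 0 := by
  intro y hy x hx
  rw [hf x y, mem_rightOrthogonal.mp hy x hx,
    mem_rightOrthogonal.mp (hf.rightOrthogonal_invariant hε hN hU y hy) x hx]
  ring

theorem IsTwisted.isCompl_rightOrthogonal [FiniteDimensional F V] (hf : IsTwisted f ε N)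
    (hε : ε * ε = 1) (hN : IsNilpotent N) (hnd : f.Nondegenerate) {U : Submodule F V}
    (hU : ∀ u ∈ U, N u ∈ U) (hUnd : (f.restrict U).Nondegenerate) :
    IsCompl U (rightOrthogonal f U) ∧ (f.restrict (rightOrthogonal f U)).Nondegenerate := by
  have h1 : ∀ x ∈ U, ∀ y ∈ rightOrthogonal f U, f x y = 0 :=
    fun x hx y hy => mem_rightOrthogonal.mp hy x hx
  have h2 := hf.apply_rightOrthogonal hε hN hU
  have hsup := sup_rightOrthogonal hUnd
  exact ⟨disjoint_of_orthogonal hnd hsup h1 h2,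
    restrict_nondegenerate_of_orthogonal hnd (sup_comm U _ ▸ hsup) h2⟩

end Complement

/-! ### F[N]-spans of families and their Gram data. -/

section EvalAt

variable {F V W ι : Type*} [Field F] [AddCommGroup V] [Module F V] [AddCommGroup W] [Module F W]
  [Fintype ι]

/-- The map `p ↦ ∑ a, p_a(N) e_a`. -/
noncomputable def evalAt (N : Module.End F V) (e : ι → V) : (ι → F[X]) →ₗ[F] V :=
  ∑ a, LinearMap.applyₗ (e a) ∘ₗ (aeval N).toLinearMap ∘ₗ LinearMap.proj a

theorem evalAt_apply (N : Module.End F V) (e : ι → V) (p : ι → F[X]) :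
    evalAt N e p = ∑ a, aeval N (p a) (e a) := by
  simp [evalAt, LinearMap.sum_apply]

theorem aeval_evalAt (N : Module.End F V) (e : ι → V) (q : F[X]) (p : ι → F[X]) :
    aeval N q (evalAt N e p) = evalAt N e (fun a => q * p a) := by
  simp [evalAt_apply, map_sum]

theorem apply_evalAt (N : Module.End F V) (e : ι → V) (p : ι → F[X]) :
    N (evalAt N e p) = evalAt N e (fun a => X * p a) := by
  rw [← aeval_evalAt, aeval_X]

theorem range_evalAt_invariant (N : Module.End F V) (e : ι → V) :
    ∀ u ∈ LinearMap.range (evalAt N e), N u ∈ LinearMap.range (evalAt N e) := by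
  rintro _ ⟨p, rfl⟩
  exact ⟨_, (apply_evalAt N e p).symm⟩

theorem mem_range_evalAt (N : Module.End F V) (e : ι → V) (a : ι) :
    e a ∈ LinearMap.range (evalAt N e) := by
  classical
  refine ⟨Pi.single a 1, ?_⟩
  rw [evalAt_apply, Finset.sum_eq_single a]
  · simp
  · intro b _ hb
    simp [Pi.single_eq_of_ne hb]
  · simp

variable {f : LinearMap.BilinForm F V} {g : LinearMap.BilinForm F W} {ε : F}
  {N : Module.End F V} {M : Module.End F W}

/-- The form `f ⊥ -g`. -/
def subForm (f : LinearMap.BilinForm F V) (g : LinearMap.BilinForm F W) :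
    LinearMap.BilinForm F (V × W) :=
  f.compl₁₂ (LinearMap.fst F V W) (LinearMap.fst F V W) -
    g.compl₁₂ (LinearMap.snd F V W) (LinearMap.snd F V W)

theorem subForm_apply (x y : V × W) : subForm f g x y = f x.1 y.1 - g x.2 y.2 := rfl

theorem IsTwisted.subForm (hf : IsTwisted f ε N) (hg : IsTwisted g ε M) :
    IsTwisted (subForm f g) ε (N.prodMap M) := by
  intro u v
  simp only [subForm_apply, LinearMap.prodMap_apply]
  rw [hf u.1 v.1, hg u.2 v.2]
  ring

theorem prodMap_pow_apply (i : ℕ) (x : V × W) :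
    ((N.prodMap M) ^ i) x = ((N ^ i) x.1, (M ^ i) x.2) := by
  induction i generalizing x with
  | zero => rfl
  | succ i ih => simp only [pow_succ, Module.End.mul_apply, ih, LinearMap.prodMap_apply]

/-- Equality of two forms is vanishing of f ⊥ -g, which is twisted by N ⊕ M, on the vectors (u, u')
and (v, v'); the vanishing lemma applies with j = 0. -/
theorem IsTwisted.apply_pow_pow_eq (hf : IsTwisted f ε N) (hg : IsTwisted g ε M)
    (hε : ε * ε = 1) {m : ℕ} (hN : N ^ m = 0) (hM : M ^ m = 0) {u v : V} {u' v' : W}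
    (h : ∀ l, f ((N ^ l) u) v = g ((M ^ l) u') v') (a b : ℕ) :
    f ((N ^ a) u) ((N ^ b) v) = g ((M ^ a) u') ((M ^ b) v') := by
  have := (hf.subForm hg).apply_pow_pow_eq_zero hε (m := m) (u := (u, u')) (v := (v, v')) (j := 0)
    (by rw [prodMap_pow_apply, hN, hM]; rfl)
    (fun l _ => by rw [prodMap_pow_apply, subForm_apply, h, sub_self]) b a (by omega)
  rwa [prodMap_pow_apply, prodMap_pow_apply, subForm_apply, sub_eq_zero] at this

theorem IsTwisted.apply_aeval_aeval_eq (hf : IsTwisted f ε N) (hg : IsTwisted g ε M)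
    (hε : ε * ε = 1) {m : ℕ} (hN : N ^ m = 0) (hM : M ^ m = 0) {u v : V} {u' v' : W}
    (h : ∀ l, f ((N ^ l) u) v = g ((M ^ l) u') v') (p q : F[X]) :
    f (aeval N p u) (aeval N q v) = g (aeval M p u') (aeval M q v') := by
  induction p using Polynomial.induction_on' with
  | add p₁ p₂ h₁ h₂ => simp [h₁, h₂]
  | monomial a r =>
    induction q using Polynomial.induction_on' with
    | add q₁ q₂ h₁ h₂ => simp only [map_add, LinearMap.add_apply, h₁, h₂]
    | monomial b s =>
      simp [aeval_monomial, hf.apply_pow_pow_eq hg hε hN hM h a b]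

theorem IsTwisted.apply_evalAt_evalAt_eq (hf : IsTwisted f ε N) (hg : IsTwisted g ε M)
    (hε : ε * ε = 1) {m : ℕ} (hN : N ^ m = 0) (hM : M ^ m = 0) {e : ι → V} {e' : ι → W}
    (h : ∀ a b l, f ((N ^ l) (e a)) (e b) = g ((M ^ l) (e' a)) (e' b)) (p q : ι → F[X]) :
    f (evalAt N e p) (evalAt N e q) = g (evalAt M e' p) (evalAt M e' q) := by
  simp only [evalAt_apply, map_sum, LinearMap.sum_apply]
  exact Finset.sum_congr rfl fun a _ => Finset.sum_congr rfl fun b _ =>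
    hf.apply_aeval_aeval_eq hg hε hN hM (h b a) _ _

/-- The Gram matrix of `f(N^n ·, ·)` on the family `e` is non-degenerate. -/
def IsRegularFamily (f : LinearMap.BilinForm F V) (N : Module.End F V) (n : ℕ) (e : ι → V) :
    Prop :=
  ∀ x : ι → F, x ≠ 0 → ∃ c, f ((N ^ n) (∑ a, x a • e a)) (e c) ≠ 0

theorem pow_aeval_apply {n : ℕ} (hN : N ^ (n + 1) = 0) (q : F[X]) (u : V) :
    (N ^ n) (aeval N q u) = q.coeff 0 • (N ^ n) u := by
  have h : N ^ n * aeval N q = q.coeff 0 • N ^ n := by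
    conv_lhs => rw [← q.X_mul_divX_add]
    rw [map_add, map_mul, aeval_X, aeval_C, mul_add, ← mul_assoc, ← pow_succ, hN, zero_mul,
      zero_add, ← Algebra.commutes, Algebra.smul_def]
  exact LinearMap.congr_fun h u

/-- Let X^d be the highest power dividing all p_a. Then N^(n-d) carries the vector to N^n of a
nontrivial linear combination of the e_a, which regularity detects; a vector left orthogonal to the
span would remain so under N. This makes the span both non-degenerate and free over F[X]/(X^(n+1)).
-/
theorem IsTwisted.exists_apply_evalAt_ne_zero (hf : IsTwisted f ε N) (hε : ε * ε = 1) {n : ℕ}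
    (hN : N ^ (n + 1) = 0) {e : ι → V} (he : IsRegularFamily f N n e) {p : ι → F[X]}
    (hp : ∃ a, ¬ X ^ (n + 1) ∣ p a) :
    ∃ y ∈ LinearMap.range (evalAt N e), f (evalAt N e p) y ≠ 0 := by
  classical
  have hex : ∃ d, ∃ a, ¬ X ^ (d + 1) ∣ p a := ⟨n, hp⟩
  set d := Nat.find hex with hd
  have hdn : d ≤ n := Nat.find_min' hex hp
  have hdvd : ∀ a, X ^ d ∣ p a := by
    intro a
    rcases hd' : d with _ | d'
    · simp
    · by_contra hcon
      exact Nat.find_min hex (m := d') (by omega) ⟨a, hcon⟩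
  obtain ⟨a₀, ha₀⟩ := Nat.find_spec hex
  choose q hq using hdvd
  obtain ⟨c, hc⟩ := he (fun a => (q a).coeff 0) (fun h0 => ha₀ (by
    have h1 : (q a₀).coeff 0 = 0 := congrFun h0 a₀
    rw [hq a₀, pow_succ]
    exact mul_dvd_mul_left _ (X_dvd_iff.mpr h1)))
  have key : (N ^ (n - d)) (evalAt N e p) = (N ^ n) (∑ a, (q a).coeff 0 • e a) := by
    have h1 : evalAt N e p = (N ^ d) (evalAt N e q) := by
      have : (N ^ d) = aeval N (X ^ d : F[X]) := by simp
      rw [this, aeval_evalAt]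
      congr 1
      exact funext hq
    rw [h1, ← Module.End.mul_apply, ← pow_add, Nat.sub_add_cancel hdn, evalAt_apply, map_sum,
      map_sum]
    exact Finset.sum_congr rfl fun a _ => by rw [pow_aeval_apply hN, map_smul]
  by_contra! hcon
  rw [← key] at hc
  exact hc (hf.pow_apply_left_eq_zero hε ⟨_, hN⟩ (range_evalAt_invariant N e) hcon _ _
    (mem_range_evalAt N e c))

theorem IsTwisted.evalAt_eq_zero_iff (hf : IsTwisted f ε N) (hε : ε * ε = 1) {n : ℕ}
    (hN : N ^ (n + 1) = 0) {e : ι → V} (he : IsRegularFamily f N n e) {p : ι → F[X]} :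
    evalAt N e p = 0 ↔ ∀ a, X ^ (n + 1) ∣ p a := by
  constructor
  · intro h
    by_contra! hcon
    obtain ⟨y, -, hy⟩ := hf.exists_apply_evalAt_ne_zero hε hN he hcon
    exact hy (by rw [h, map_zero, LinearMap.zero_apply])
  · intro h
    rw [evalAt_apply]
    refine Finset.sum_eq_zero fun a _ => ?_
    obtain ⟨q, hq⟩ := h a
    rw [hq, map_mul, map_pow, aeval_X, hN, zero_mul, LinearMap.zero_apply]

theorem IsTwisted.restrict_range_evalAt_nondegenerate [FiniteDimensional F V]
    (hf : IsTwisted f ε N) (hε : ε * ε = 1) {n : ℕ}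
    (hN : N ^ (n + 1) = 0) {e : ι → V} (he : IsRegularFamily f N n e) :
    (f.restrict (LinearMap.range (evalAt N e))).Nondegenerate := by
  refine nondegenerate_of_left ?_
  rintro ⟨_, p, rfl⟩ hx
  refine Subtype.ext ((hf.evalAt_eq_zero_iff hε hN he).mpr ?_)
  by_contra! hcon
  obtain ⟨y, hy, hne⟩ := hf.exists_apply_evalAt_ne_zero hε hN he hcon
  exact hne (hx ⟨y, hy⟩)

end EvalAt

/-! ### The top-degree form f(N^n ·, ·) and its alternating type. -/

section Alternating

variable {F V W : Type*} [Field F] [AddCommGroup V] [Module F V] [AddCommGroup W] [Module F W]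
  {f : LinearMap.BilinForm F V} {g : LinearMap.BilinForm F W} {ε : F}
  {N : Module.End F V} {M : Module.End F W}

/-- The form `f(N^n ·, ·)` is alternating on `ker N^(n+1)`. -/
def IsAltAt (f : LinearMap.BilinForm F V) (N : Module.End F V) (n : ℕ) : Prop :=
  ∀ u, (N ^ (n + 1)) u = 0 → f ((N ^ n) u) u = 0

theorem IsAltAt.restrict {n : ℕ} (h : IsAltAt f N n) {U : Submodule F V}
    (hU : ∀ u ∈ U, N u ∈ U) : IsAltAt (f.restrict U) (N.restrict hU) n := by
  intro u hu
  have h1 := h u (by rw [← coe_restrict_pow hU, hu]; rfl)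
  rwa [← coe_restrict_pow hU] at h1

theorem isAltAt_of_pow_eq_zero {n : ℕ} (h : N ^ n = 0) : IsAltAt f N n := by
  intro u _
  rw [h, LinearMap.zero_apply, map_zero, LinearMap.zero_apply]

theorem IsTwisted.apply_pow_pow_eq_zero_of_pow (hf : IsTwisted f ε N) (hε : ε * ε = 1) {m : ℕ}
    (hN : N ^ m = 0) (x y : V) {a b : ℕ} (hab : m ≤ a + b) :
    f ((N ^ a) x) ((N ^ b) y) = 0 := by
  have hN0 : (N ^ m) x = 0 := by rw [hN]; rfl
  exact hf.apply_pow_pow_eq_zero hε hN0 (j := m)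
    (fun l hl => by rw [pow_apply_eq_zero_of_le hN0 hl, map_zero, LinearMap.zero_apply]) b a hab

/-- In top degree only the leading term -N of the adjoint of N survives. -/
theorem IsTwisted.apply_pow_top_comm (hf : IsTwisted f ε N) (hε : ε * ε = 1) {n : ℕ}
    (hN : N ^ (n + 1) = 0) (u v : V) :
    f ((N ^ n) v) u = ε * (-1) ^ n * f ((N ^ n) u) v := by
  have h0 := hf u ((N ^ n) v)
  have h1 : N ((N ^ n) v) = 0 := by
    rw [← Module.End.mul_apply, ← pow_succ', hN]; rfl
  have h2 := hf.apply_pow_pow_top hε (by rw [hN]; rfl : (N ^ (n + 1)) u = 0) (v := v) (j := n)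
    (fun l hl => by simpa using hf.apply_pow_pow_eq_zero_of_pow hε hN u v (a := l) (b := 0) hl)
    n 0 (by omega)
  rw [pow_zero, Module.End.one_apply] at h2
  rw [h0, h1, h2, map_zero]
  ring

theorem exists_apply_pow_ne_zero (hnd : f.Nondegenerate) {n : ℕ} (hn : N ^ n ≠ 0) :
    ∃ u v, f ((N ^ n) u) v ≠ 0 := by
  by_contra! h
  exact hn (LinearMap.ext fun u => hnd.1 _ (h u))

/-- Outside characteristic two a nonzero ε(-1)^n-symmetric form is alternating exactly when the sign
is -1, so the type depends on ε and n alone. -/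
theorem IsTwisted.isAltAt_iff_isRigid (hf : IsTwisted f ε N) (hε : ε * ε = 1)
    (hnd : f.Nondegenerate) {n : ℕ} (hN : N ^ (n + 1) = 0) (hn : N ^ n ≠ 0) (h2 : (2 : F) ≠ 0) :
    IsAltAt f N n ↔ IsRigid ε n := by
  constructor
  · intro h
    have h1 : (ε * (-1) ^ n) * (ε * (-1) ^ n) = 1 := by
      have : ((-1 : F) ^ n) * (-1) ^ n = 1 := by rw [← mul_pow]; simp
      linear_combination ε * ε * this + hε
    rcases mul_self_eq_one_iff.mp h1 with h3 | h3
    · exfalso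
      obtain ⟨u, v, huv⟩ := exists_apply_pow_ne_zero hnd hn
      have e1 := h (u + v) (by rw [hN]; rfl)
      have e2 := hf.apply_pow_top_comm hε hN u v
      rw [h3, one_mul] at e2
      simp only [map_add, LinearMap.add_apply, h u (by rw [hN]; rfl), h v (by rw [hN]; rfl),
        e2] at e1
      apply huv
      have : 2 * f ((N ^ n) u) v = 0 := by linear_combination e1
      exact (mul_eq_zero.mp this).resolve_left h2
    · exact Or.inl ⟨h2, h3⟩
  · intro h u _
    refine hf.apply_self_eq_zero hε (m := n + 1) (by rw [hN]; rfl) h fun l hl => ?_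
    simpa using hf.apply_pow_pow_eq_zero_of_pow hε hN u u (a := l) (b := 0) hl

theorem IsTwisted.isAltAt_of_isRigid (hf : IsTwisted f ε N) (hε : ε * ε = 1) {n : ℕ}
    (h : IsRigid ε n) : IsAltAt f N n := by
  intro u hu
  refine hf.apply_self_eq_zero hε hu h fun l hl => ?_
  rw [pow_apply_eq_zero_of_le hu hl, map_zero, LinearMap.zero_apply]

theorem pow_eq_zero_iff_finrank_ker [FiniteDimensional F V] (j : ℕ) :
    N ^ j = 0 ↔ Module.finrank F (LinearMap.ker (N ^ j)) = Module.finrank F V := by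
  rw [← LinearMap.ker_eq_top]
  exact ⟨fun h => by rw [h, finrank_top], Submodule.eq_top_of_finrank_eq⟩

end Alternating

/-! ### Effect of splitting off a free summand. -/

section Split

variable {F V W ι : Type*} [Field F] [AddCommGroup V] [Module F V] [AddCommGroup W] [Module F W]
  [Fintype ι] {f : LinearMap.BilinForm F V} {g : LinearMap.BilinForm F W} {ε : F}
  {N : Module.End F V} {M : Module.End F W} {n : ℕ}

/-- By freeness a = N^(n-l) b, so the value is f(N^n b, N^(n-l) b), of total degree above n. Blocks
of size n + 1 thus do not affect the alternating type in lower degrees. -/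
theorem IsTwisted.apply_pow_self_of_mem_range (hf : IsTwisted f ε N) (hε : ε * ε = 1)
    (hN : N ^ (n + 1) = 0) {e : ι → V} (he : IsRegularFamily f N n e) {l : ℕ} (hl : l < n)
    {a : V} (ha : a ∈ LinearMap.range (evalAt N e)) (h0 : (N ^ (l + 1)) a = 0) :
    f ((N ^ l) a) a = 0 := by
  obtain ⟨p, rfl⟩ := ha
  have hX : N ^ (l + 1) = aeval N (X ^ (l + 1) : F[X]) := by simp
  rw [hX, aeval_evalAt, hf.evalAt_eq_zero_iff hε hN he] at h0
  have hd : ∀ a, X ^ (n - l) ∣ p a := fun a => by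
    have := h0 a
    rw [show n + 1 = (l + 1) + (n - l) by omega, pow_add] at this
    exact (mul_dvd_mul_iff_left (pow_ne_zero _ X_ne_zero)).mp this
  choose q hq using hd
  have h1 : evalAt N e p = (N ^ (n - l)) (evalAt N e q) := by
    have : (N ^ (n - l)) = aeval N (X ^ (n - l) : F[X]) := by simp
    rw [this, aeval_evalAt]
    congr 1
    exact funext hq
  rw [h1, ← Module.End.mul_apply, ← pow_add]
  exact hf.apply_pow_pow_eq_zero_of_pow hε hN _ _ (by omega)

theorem IsTwisted.isAltAt_restrict_iff [FiniteDimensional F V] (hf : IsTwisted f ε N)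
    (hε : ε * ε = 1) (hnd : f.Nondegenerate)
    (hN : N ^ (n + 1) = 0) {e : ι → V} (he : IsRegularFamily f N n e)
    (hR : ∀ y ∈ rightOrthogonal f (LinearMap.range (evalAt N e)),
      N y ∈ rightOrthogonal f (LinearMap.range (evalAt N e))) {l : ℕ} (hl : l < n) :
    IsAltAt (f.restrict (rightOrthogonal f (LinearMap.range (evalAt N e)))) (N.restrict hR) l ↔
      IsAltAt f N l := by
  refine ⟨fun h u hu => ?_, fun h => h.restrict hR⟩
  set U := LinearMap.range (evalAt N e) with hUdef
  have hU : ∀ u ∈ U, N u ∈ U := range_evalAt_invariant N e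
  obtain ⟨hc, -⟩ := hf.isCompl_rightOrthogonal hε ⟨_, hN⟩ hnd hU
    (hf.restrict_range_evalAt_nondegenerate hε hN he)
  obtain ⟨a, ha, r, hr, rfl⟩ := Submodule.mem_sup.mp
    (hc.sup_eq_top ▸ Submodule.mem_top : u ∈ U ⊔ rightOrthogonal f U)
  have h1 := pow_mem_of_invariant hU (l + 1) ha
  have h2 := pow_mem_of_invariant hR (l + 1) hr
  rw [map_add] at hu
  have h3 : (N ^ (l + 1)) a = 0 := by
    refine Submodule.disjoint_def.mp hc.disjoint _ h1 ?_
    rw [eq_neg_of_add_eq_zero_left hu]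
    exact Submodule.neg_mem _ h2
  have h4 : (N ^ (l + 1)) r = 0 := by rwa [h3, zero_add] at hu
  have h5 : f ((N ^ l) r) r = 0 := by
    have := h ⟨r, hr⟩ (Subtype.ext (by rw [coe_restrict_pow]; exact h4))
    rwa [LinearMap.BilinForm.restrict_apply, LinearMap.domRestrict_apply, coe_restrict_pow] at this
  have h6 := hf.apply_pow_self_of_mem_range hε hN he hl ha h3
  have h7 := mem_rightOrthogonal.mp hr _ (pow_mem_of_invariant hU l ha)
  have h8 := hf.apply_rightOrthogonal hε ⟨_, hN⟩ hU _ (pow_mem_of_invariant hR l hr) _ ha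
  simp only [map_add, LinearMap.add_apply, h5, h6, h7, h8, add_zero]

/-- The subspaces spanned by regular families with the same Gram data are equivalent. -/
theorem IsTwisted.restrict_range_equivalent [FiniteDimensional F V] [FiniteDimensional F W]
    (hf : IsTwisted f ε N) (hg : IsTwisted g ε M) (hε : ε * ε = 1)
    (hN : N ^ (n + 1) = 0) (hM : M ^ (n + 1) = 0) {e : ι → V} {e' : ι → W}
    (he : IsRegularFamily f N n e) (he' : IsRegularFamily g M n e')
    (h : ∀ a b l, f ((N ^ l) (e a)) (e b) = g ((M ^ l) (e' a)) (e' b)) :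
    FormsEquivalent (f.restrict (LinearMap.range (evalAt N e)))
      (g.restrict (LinearMap.range (evalAt M e'))) ∧
    ∀ j, Module.finrank F
        (LinearMap.ker ((N.restrict (range_evalAt_invariant N e)) ^ j)) =
      Module.finrank F (LinearMap.ker ((M.restrict (range_evalAt_invariant M e')) ^ j)) := by
  obtain ⟨x, hx, hxe⟩ := FormsEquivalent.of_surjective
    (hf.restrict_range_evalAt_nondegenerate hε hN he)
    (hg.restrict_range_evalAt_nondegenerate hε hM he')
    (evalAt N e).rangeRestrict (evalAt M e').rangeRestrict
    (evalAt N e).surjective_rangeRestrict (evalAt M e').surjective_rangeRestrict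
    (fun p q => hf.apply_evalAt_evalAt_eq hg hε hN hM h p q)
  refine ⟨⟨x, hx⟩, fun j => ?_⟩
  set N' := N.restrict (range_evalAt_invariant N e)
  set M' := M.restrict (range_evalAt_invariant M e')
  have hcomm : ∀ u, x (N' u) = M' (x u) := by
    intro u
    obtain ⟨p, rfl⟩ := (evalAt N e).surjective_rangeRestrict u
    have h1 : N' ((evalAt N e).rangeRestrict p) = (evalAt N e).rangeRestrict (fun a => X * p a) :=
      Subtype.ext (apply_evalAt N e p)
    have h2 : M' ((evalAt M e').rangeRestrict p) =
        (evalAt M e').rangeRestrict (fun a => X * p a) :=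
      Subtype.ext (apply_evalAt M e' p)
    rw [h1, hxe, hxe, h2]
  have hpow : ∀ j u, x ((N' ^ j) u) = (M' ^ j) (x u) := by
    intro j
    induction j with
    | zero => intro u; rfl
    | succ j ih =>
      intro u
      rw [pow_succ, pow_succ, Module.End.mul_apply, Module.End.mul_apply, ih, hcomm]
  suffices hmap : (LinearMap.ker (N' ^ j)).map (x : _ →ₗ[F] _) = LinearMap.ker (M' ^ j) by
    rw [← hmap, LinearEquiv.finrank_map_eq]
  ext w
  constructor
  · rintro ⟨u, hu, rfl⟩
    rw [SetLike.mem_coe, LinearMap.mem_ker] at hu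
    rw [LinearMap.mem_ker]
    exact (hpow j u).symm.trans (by rw [hu, map_zero])
  · intro hw
    refine ⟨x.symm w, ?_, x.apply_symm_apply w⟩
    rw [SetLike.mem_coe, LinearMap.mem_ker]
    apply x.injective
    rw [hpow, x.apply_symm_apply, map_zero]
    exact hw

end Split

/-! ### Choosing generators of the summand to be split off. -/

section Generators

variable {F V W : Type*} [Field F] [AddCommGroup V] [Module F V] [AddCommGroup W] [Module F W]
  {f : LinearMap.BilinForm F V} {g : LinearMap.BilinForm F W} {ε : F}
  {N : Module.End F V} {M : Module.End F W} {n : ℕ}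

theorem IsTwisted.isRegularFamily_singleton {u : V} (hu : f ((N ^ n) u) u ≠ 0) :
    IsRegularFamily f N n (fun _ : Fin 1 => u) := by
  intro x hx
  have h0 : x 0 ≠ 0 := fun h => hx (funext fun i => by rw [Subsingleton.elim i 0, h]; rfl)
  exact ⟨0, by simpa using ⟨h0, hu⟩⟩

/-- A vector `u` with `f(N^n u, u) ≠ 0` whose orthogonal complement is, in characteristic two,
non-alternating for `f(N^n ·, ·)` unless that form vanishes on it. -/
def IsSplitter (f : LinearMap.BilinForm F V) (N : Module.End F V) (n : ℕ) (u : V) : Prop :=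
  f ((N ^ n) u) u ≠ 0 ∧ ((2 : F) = 0 →
    (∃ y, f ((N ^ n) u) y = 0 ∧ f ((N ^ n) y) y ≠ 0) ∨
      ∀ z, f ((N ^ n) u) z = 0 → (N ^ n) z = 0)

theorem IsSplitter.of_pow_eq_smul {u w : V} (hu : IsSplitter f N n u) {c : F}
    (h : (N ^ n) w = c • (N ^ n) u) (hw : f ((N ^ n) w) w ≠ 0) : IsSplitter f N n w := by
  have hc : c ≠ 0 := by
    rintro rfl
    exact hw (by rw [h, zero_smul, map_zero, LinearMap.zero_apply])
  have key : ∀ z, f ((N ^ n) w) z = 0 ↔ f ((N ^ n) u) z = 0 := by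
    intro z
    rw [h, map_smul, LinearMap.smul_apply, smul_eq_mul, mul_eq_zero, or_iff_right hc]
  exact ⟨hw, fun h2 => by simpa only [key] using hu.2 h2⟩

/-- Write h = f(N^n ·, ·) in characteristic two. If u is no splitter, its h-complement is
alternating but contains z with N^n z ≠ 0. For y' in this complement with h(z, y') = h(u, u), the
vector u + z is a splitter: u + y' is h-orthogonal to it because 2 = 0, and h(u + y', u + y') = h(u,
u). -/
theorem IsTwisted.exists_isSplitter (hf : IsTwisted f ε N) (hε : ε * ε = 1)
    (hnd : f.Nondegenerate) (hN : N ^ (n + 1) = 0) {u : V} (hu : f ((N ^ n) u) u ≠ 0) :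
    ∃ w, IsSplitter f N n w := by
  by_cases h2 : (2 : F) = 0
  swap
  · exact ⟨u, hu, fun h => absurd h h2⟩
  by_cases hy : ∃ y, f ((N ^ n) u) y = 0 ∧ f ((N ^ n) y) y ≠ 0
  · exact ⟨u, hu, fun _ => Or.inl hy⟩
  by_cases hz : ∀ z, f ((N ^ n) u) z = 0 → (N ^ n) z = 0
  · exact ⟨u, hu, fun _ => Or.inr hz⟩
  push Not at hy hz
  obtain ⟨z, huz, hz⟩ := hz
  obtain ⟨y, hzy⟩ : ∃ y, f ((N ^ n) z) y ≠ 0 := by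
    by_contra! h
    exact hz (hnd.1 _ h)
  have hsymm : ∀ x y, f ((N ^ n) y) x = f ((N ^ n) x) y := fun x y => by
    rw [hf.apply_pow_top_comm hε hN, eq_one_of_mul_self h2 hε, neg_one_eq_one h2]
    simp
  obtain ⟨y', h1, h3⟩ : ∃ y', f ((N ^ n) u) y' = 0 ∧ f ((N ^ n) z) y' = f ((N ^ n) u) u := by
    refine ⟨(f ((N ^ n) u) u / f ((N ^ n) z) y) •
      (y - (f ((N ^ n) u) y / f ((N ^ n) u) u) • u), ?_, ?_⟩
    · simp only [map_smul, map_sub, smul_eq_mul]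
      field_simp
      ring
    · simp only [map_smul, map_sub, smul_eq_mul, hsymm u z, huz]
      field_simp
      ring
  have h4 := hy z huz
  have h5 := hy y' h1
  have h6 := hsymm u z
  have h7 := hsymm u y'
  refine ⟨u + z, ?_, fun _ => Or.inl ⟨u + y', ?_, ?_⟩⟩
  · simpa [huz, h4, h6] using hu
  · simp only [map_add, LinearMap.add_apply, h6, h3, h1, huz]
    linear_combination f ((N ^ n) u) u * h2
  · simpa [h5, h7, h1] using hu

/-- Write the witness y as a + r with a in F[N]u and r orthogonal to it. Orthogonality of y to N^n u
forces N^n a = 0, so y and r have the same value under f(N^n ·, ·). -/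
theorem IsTwisted.isSplitter_complement [FiniteDimensional F V] (hf : IsTwisted f ε N)
    (hε : ε * ε = 1) (hnd : f.Nondegenerate) (hN : N ^ (n + 1) = 0) {u : V}
    (hu : IsSplitter f N n u) (h2 : (2 : F) = 0)
    (hR : ∀ y ∈ rightOrthogonal f (LinearMap.range (evalAt N (fun _ : Fin 1 => u))),
      N y ∈ rightOrthogonal f (LinearMap.range (evalAt N (fun _ : Fin 1 => u)))) :
    ¬ IsAltAt (f.restrict (rightOrthogonal f (LinearMap.range (evalAt N (fun _ : Fin 1 => u)))))
        (N.restrict hR) n ∨ (N.restrict hR) ^ n = 0 := by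
  set e : Fin 1 → V := fun _ => u
  set U := LinearMap.range (evalAt N e) with hUdef
  have hU : ∀ u ∈ U, N u ∈ U := range_evalAt_invariant N e
  have he : IsRegularFamily f N n e := IsTwisted.isRegularFamily_singleton hu.1
  obtain ⟨hc, -⟩ := hf.isCompl_rightOrthogonal hε ⟨_, hN⟩ hnd hU
    (hf.restrict_range_evalAt_nondegenerate hε hN he)
  have huU : u ∈ U := mem_range_evalAt N e 0
  rcases hu.2 h2 with ⟨y, hy, hyy⟩ | hz
  · left
    intro halt
    obtain ⟨a, ha, r, hr, rfl⟩ := Submodule.mem_sup.mp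
      (hc.sup_eq_top ▸ Submodule.mem_top : y ∈ U ⊔ rightOrthogonal f U)
    rw [map_add, mem_rightOrthogonal.mp hr _ (pow_mem_of_invariant hU n huU), add_zero] at hy
    have h0 : (N ^ n) a = 0 := by
      obtain ⟨p, rfl⟩ := ha
      rw [evalAt_apply, Fin.sum_univ_one, hf.apply_pow_top_comm hε hN, pow_aeval_apply hN,
        map_smul, LinearMap.smul_apply, smul_eq_mul] at hy
      have hne : ε * (-1) ^ n ≠ 0 := mul_ne_zero (fun h => by simp [h] at hε)
        (pow_ne_zero _ (by simp))
      have hp := (mul_eq_zero.mp ((mul_eq_zero.mp hy).resolve_left hne)).resolve_right hu.1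
      rw [evalAt_apply, Fin.sum_univ_one, pow_aeval_apply hN, hp, zero_smul]
    have h5 := halt ⟨r, hr⟩ (Subtype.ext (by rw [coe_restrict_pow, hN]; rfl))
    rw [LinearMap.BilinForm.restrict_apply, LinearMap.domRestrict_apply, coe_restrict_pow] at h5
    have h8 := hf.apply_rightOrthogonal hε ⟨_, hN⟩ hU _ (pow_mem_of_invariant hR n hr) _ ha
    apply hyy
    simp only [map_add, h0, zero_add, h8]
    exact h5
  · right
    ext ⟨r, hr⟩
    rw [coe_restrict_pow]
    exact hz r (mem_rightOrthogonal.mp hr _ (pow_mem_of_invariant hU n huU))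

/-- After scaling the top value to 1, subtracting multiples of N^(d+1) w clears the value in degree
n - (d + 1) without changing higher degrees. -/
theorem IsTwisted.exists_pow_apply_eq_ite {Y : Submodule F V}
    (hN : N ^ (n + 1) = 0) (hY : ∀ y ∈ Y, N y ∈ Y) {u v : V} (hu : u ∈ Y)
    (huv : f ((N ^ n) u) v ≠ 0) :
    ∃ w ∈ Y, ∀ l, f ((N ^ l) w) v = if l = n then 1 else 0 := by
  have hbig : ∀ x l, n < l → f ((N ^ l) x) v = 0 := fun x l hl => by
    rw [pow_apply_eq_zero_of_le (by rw [hN]; rfl : (N ^ (n + 1)) x = 0) hl, map_zero,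
      LinearMap.zero_apply]
  have main : ∀ d ≤ n, ∃ w ∈ Y, ∀ l, n - d ≤ l → f ((N ^ l) w) v = if l = n then 1 else 0 := by
    intro d
    induction d with
    | zero =>
      intro _
      refine ⟨(f ((N ^ n) u) v)⁻¹ • u, Y.smul_mem _ hu, fun l hl => ?_⟩
      split_ifs with h
      · subst h
        simp [huv]
      · exact hbig _ l (by omega)
    | succ d ih =>
      intro hd
      obtain ⟨w, hw, h⟩ := ih (by omega)
      refine ⟨w - f ((N ^ (n - (d + 1))) w) v • (N ^ (d + 1)) w,
        Y.sub_mem hw (Y.smul_mem _ (pow_mem_of_invariant hY _ hw)), fun l hl => ?_⟩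
      rw [map_sub, map_smul, ← Module.End.mul_apply, ← pow_add, map_sub, map_smul,
        LinearMap.sub_apply, LinearMap.smul_apply, smul_eq_mul]
      rcases Nat.lt_or_ge l (n - d) with hl' | hl'
      · obtain rfl : l = n - (d + 1) := by omega
        rw [Nat.sub_add_cancel hd, h n (by omega), if_pos rfl, if_neg (by omega)]
        ring
      · rw [h l hl', hbig _ (l + (d + 1)) (by omega)]
        ring
  obtain ⟨w, hw, h⟩ := main n le_rfl
  exact ⟨w, hw, fun l => h l (by omega)⟩

/-- In the alternating case there is a hyperbolic pair of generators. -/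
theorem IsTwisted.exists_hyperbolic (hF : IsQuadraticallyClosed F) (hf : IsTwisted f ε N)
    (hε : ε * ε = 1) (hnd : f.Nondegenerate) (hN : N ^ (n + 1) = 0) (hn : N ^ n ≠ 0)
    (halt : IsAltAt f N n) :
    ∃ u v, (∀ l, f ((N ^ l) u) u = 0) ∧ (∀ l, f ((N ^ l) v) v = 0) ∧
      ∀ l, f ((N ^ l) u) v = if l = n then 1 else 0 := by
  have halt' : ∀ x, f ((N ^ n) x) x = 0 := fun x => halt x (by rw [hN]; rfl)
  obtain ⟨u, v, huv⟩ := exists_apply_pow_ne_zero hnd hn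
  obtain ⟨u₁, -, h1, h2⟩ := hf.exists_isotropic hF hε hN (Y := ⊤) (by simp)
    (Submodule.mem_top : v ∈ ⊤) huv (halt' u)
  have hne : f ((N ^ n) v) u₁ ≠ 0 := by
    rw [hf.apply_pow_top_comm hε hN]
    exact mul_ne_zero (mul_ne_zero (fun h => by simp [h] at hε) (pow_ne_zero _ (by simp))) h1
  obtain ⟨v₁, -, h3, h4⟩ := hf.exists_isotropic hF hε hN (Y := ⊤) (by simp)
    (Submodule.mem_top : u₁ ∈ ⊤) hne (halt' v)
  have hne' : f ((N ^ n) u₁) v₁ ≠ 0 := by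
    rw [hf.apply_pow_top_comm hε hN]
    exact mul_ne_zero (mul_ne_zero (fun h => by simp [h] at hε) (pow_ne_zero _ (by simp))) h3
  obtain ⟨w, ⟨p, rfl⟩, h5⟩ := IsTwisted.exists_pow_apply_eq_ite (f := f) (v := v₁) hN
    (range_evalAt_invariant N (fun _ : Fin 1 => u₁)) (mem_range_evalAt N _ 0) hne'
  refine ⟨_, v₁, fun l => ?_, h4, h5⟩
  -- Comparison with the zero form, which is trivially twisted: since f(N^l u₁, u₁) = 0 for all l,
  -- the whole span F[N]u₁ is totally isotropic, in particular the new generator.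
  have hzero : IsTwisted (0 : LinearMap.BilinForm F V) ε N := fun u v => by simp
  have hX : N ^ l = aeval N (X ^ l : F[X]) := by simp
  rw [evalAt_apply, Fin.sum_univ_one, hX, ← Module.End.mul_apply, ← map_mul,
    hf.apply_aeval_aeval_eq hzero hε hN hN (u' := u₁) (v' := u₁) (fun l => by rw [h2]; rfl)]
  rfl

theorem IsTwisted.isRegularFamily_pair (hf : IsTwisted f ε N) (hε : ε * ε = 1)
    (hN : N ^ (n + 1) = 0) {u v : V} (hv : f ((N ^ n) v) v = 0)
    (huv : f ((N ^ n) u) v = 1) : IsRegularFamily f N n ![u, v] := by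
  intro x hx
  have hne : ε * (-1) ^ n ≠ 0 := mul_ne_zero (fun h => by simp [h] at hε) (pow_ne_zero _ (by simp))
  have hvu := hf.apply_pow_top_comm hε hN u v
  rw [huv, mul_one] at hvu
  by_cases h0 : x 0 = 0
  · have h1 : x 1 ≠ 0 := fun h1 => hx (funext fun i => by fin_cases i <;> simp [h0, h1])
    refine ⟨0, ?_⟩
    simpa [Fin.sum_univ_two, h0, hvu] using ⟨h1, fun h => by simp [h] at hε⟩
  · refine ⟨1, ?_⟩
    simpa [Fin.sum_univ_two, huv, hv] using h0

end Generators

/-! ### Classification of twisted forms with nilpotent operator. -/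

section Induction

universe u v

variable {F : Type*} [Field F]

theorem IsTwisted.exists_splitters {V W : Type*} [AddCommGroup V] [Module F V] [AddCommGroup W]
    [Module F W] {f : LinearMap.BilinForm F V} {g : LinearMap.BilinForm F W} {ε : F}
    {N : Module.End F V} {M : Module.End F W} {n : ℕ}
    (hF : IsQuadraticallyClosed F) (hf : IsTwisted f ε N) (hg : IsTwisted g ε M)
    (hε : ε * ε = 1) (hfnd : f.Nondegenerate) (hgnd : g.Nondegenerate)
    (hN : N ^ (n + 1) = 0) (hM : M ^ (n + 1) = 0)
    (hfa : ¬ IsAltAt f N n) (hga : ¬ IsAltAt g M n) :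
    ∃ u u', IsSplitter f N n u ∧ IsSplitter g M n u' ∧
      ∀ l, f ((N ^ l) u) u = g ((M ^ l) u') u' := by
  simp only [IsAltAt, not_forall] at hfa hga
  obtain ⟨u₀, -, hu₀⟩ := hfa
  obtain ⟨w₀, -, hw₀⟩ := hga
  obtain ⟨u, hu⟩ := hf.exists_isSplitter hε hfnd hN hu₀
  obtain ⟨w, hw⟩ := hg.exists_isSplitter hε hgnd hM hw₀
  -- Scaling w by a square root makes (u, cw) isotropic in top degree for f ⊥ -g.
  obtain ⟨c, hc⟩ := hF 0 (-(f ((N ^ n) u) u / g ((M ^ n) w) w))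
  have hc' : c ^ 2 * g ((M ^ n) w) w = f ((N ^ n) u) u := by
    have h1 : c ^ 2 = f ((N ^ n) u) u / g ((M ^ n) w) w := by linear_combination hc
    rw [h1, div_mul_cancel₀ _ hw.1]
  have hcw : g ((M ^ n) (c • w)) (c • w) = f ((N ^ n) u) u := by
    rw [← hc']
    simp only [map_smul, LinearMap.smul_apply, smul_eq_mul]
    ring
  have hw' : IsSplitter g M n (c • w) :=
    hw.of_pow_eq_smul (map_smul _ _ _) (by rw [hcw]; exact hu.1)
  set e : Fin 1 → V := fun _ => u
  have hY : ∀ y ∈ (LinearMap.range (evalAt N e)).map (LinearMap.inl F V W),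
      (N.prodMap M) y ∈ (LinearMap.range (evalAt N e)).map (LinearMap.inl F V W) := by
    rintro _ ⟨y, hy, rfl⟩
    exact ⟨N y, range_evalAt_invariant N e y hy, by simp⟩
  -- Only corrections in F[N]u × 0 are allowed, so the second component stays cw. Isotropy of (u₁,
  -- cw) in every degree says that u₁ and cw have the same numbers.
  obtain ⟨⟨u₁, w₁⟩, ⟨y, ⟨p, rfl⟩, hy⟩, h1, h2⟩ := (hf.subForm hg).exists_isotropic hF hε (n := n)
    (LinearMap.ext fun x => by rw [prodMap_pow_apply, hN, hM]; rfl) hY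
    (z := (u, c • w)) (v := (u, 0)) ⟨u, mem_range_evalAt N e 0, rfl⟩
    (by rw [prodMap_pow_apply, subForm_apply]; simpa using hu.1)
    (by rw [prodMap_pow_apply, subForm_apply, hcw, sub_self])
  rw [evalAt_apply, Fin.sum_univ_one, LinearMap.inl_apply, Prod.mk_sub_mk, Prod.mk.injEq,
    eq_comm, sub_eq_iff_eq_add, eq_comm (a := (0 : W)), sub_eq_zero] at hy
  obtain ⟨hy1, rfl⟩ := hy
  have h3 : ∀ l, f ((N ^ l) u₁) u₁ = g ((M ^ l) (c • w)) (c • w) := fun l => by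
    have := h2 l
    rwa [prodMap_pow_apply, subForm_apply, sub_eq_zero] at this
  refine ⟨u₁, c • w, hu.of_pow_eq_smul (c := (p 0).coeff 0 + 1) ?_ ?_, hw', h3⟩
  · rw [hy1, map_add, pow_aeval_apply hN, add_smul, one_smul]
  · rw [h3, hcw]
    exact hu.1

/-- Two nilpotent twisted forms are equivalent if the kernels of the powers of the nilpotent
operators have the same dimensions and, in characteristic two, the associated forms on these
kernels are alternating simultaneously. -/
theorem IsTwisted.formsEquivalent (hF : IsQuadraticallyClosed F) {ε : F} (hε : ε * ε = 1) (d : ℕ) :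
    ∀ {V : Type u} {W : Type v} [AddCommGroup V] [Module F V] [FiniteDimensional F V]
      [AddCommGroup W] [Module F W] [FiniteDimensional F W]
      {f : LinearMap.BilinForm F V} {g : LinearMap.BilinForm F W}
      {N : Module.End F V} {M : Module.End F W},
      Module.finrank F V = d → IsTwisted f ε N → IsTwisted g ε M →
      IsNilpotent N → IsNilpotent M → f.Nondegenerate → g.Nondegenerate →
      (∀ j, Module.finrank F (LinearMap.ker (N ^ j)) = Module.finrank F (LinearMap.ker (M ^ j))) →
      ((2 : F) = 0 → ∀ n, IsAltAt f N n ↔ IsAltAt g M n) → FormsEquivalent f g := by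
  induction d using Nat.strong_induction_on with
  | _ d ih =>
  intro V W _ _ _ _ _ _ f g N M hd hf hg hNn hMn hfnd hgnd hker halt
  have hdim : Module.finrank F V = Module.finrank F W := by
    obtain ⟨a, ha⟩ := hNn
    obtain ⟨b, hb⟩ := hMn
    rw [← (pow_eq_zero_iff_finrank_ker (N := N) (a + b)).mp (by rw [pow_add, ha, zero_mul]),
      ← (pow_eq_zero_iff_finrank_ker (N := M) (a + b)).mp (by rw [pow_add, hb, mul_zero]), hker]
  have hzero : ∀ j, N ^ j = 0 ↔ M ^ j = 0 := fun j => by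
    rw [pow_eq_zero_iff_finrank_ker, pow_eq_zero_iff_finrank_ker, hker, hdim]
  rcases subsingleton_or_nontrivial V with hV | hV
  · exact FormsEquivalent.of_linearMap hfnd hdim 0 fun u v => by
      rw [Subsingleton.elim u 0]; simp
  obtain ⟨n, hn, hN⟩ : ∃ n, N ^ n ≠ 0 ∧ N ^ (n + 1) = 0 := by
    classical
    refine ⟨Nat.find hNn - 1, Nat.find_min hNn ?_, ?_⟩
    · have : Nat.find hNn ≠ 0 := fun h => by
        have := Nat.find_spec hNn
        rw [h, pow_zero] at this
        exact one_ne_zero this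
      omega
    · have : Nat.find hNn ≠ 0 := fun h => by
        have := Nat.find_spec hNn
        rw [h, pow_zero] at this
        exact one_ne_zero this
      rw [Nat.sub_add_cancel (by omega)]
      exact Nat.find_spec hNn
  have hM := (hzero _).mp hN
  have hm : M ^ n ≠ 0 := fun h => hn ((hzero n).mpr h)
  have haltn : IsAltAt f N n ↔ IsAltAt g M n := by
    by_cases h2 : (2 : F) = 0
    · exact halt h2 n
    · rw [hf.isAltAt_iff_isRigid hε hfnd hN hn h2, hg.isAltAt_iff_isRigid hε hgnd hM hm h2]
  -- Splitting off equivalent summands and applying the induction hypothesis to the complements.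
  -- Degrees below n are unaffected and above n all powers vanish, so only the type in degree n on
  -- the complements is left as a condition.
  have step : ∀ (k : ℕ) (e : Fin (k + 1) → V) (e' : Fin (k + 1) → W),
      IsRegularFamily f N n e → IsRegularFamily g M n e' →
      (∀ a b l, f ((N ^ l) (e a)) (e b) = g ((M ^ l) (e' a)) (e' b)) →
      ((2 : F) = 0 → ∀ hR hR',
        (∀ j, Module.finrank F (LinearMap.ker
          ((N.restrict (p := rightOrthogonal f (LinearMap.range (evalAt N e)))
            (q := rightOrthogonal f (LinearMap.range (evalAt N e))) hR) ^ j)) =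
          Module.finrank F (LinearMap.ker
          ((M.restrict (p := rightOrthogonal g (LinearMap.range (evalAt M e')))
            (q := rightOrthogonal g (LinearMap.range (evalAt M e'))) hR') ^ j))) →
        (IsAltAt (f.restrict (rightOrthogonal f (LinearMap.range (evalAt N e))))
          (N.restrict hR) n ↔
        IsAltAt (g.restrict (rightOrthogonal g (LinearMap.range (evalAt M e'))))
          (M.restrict hR') n)) → FormsEquivalent f g := by
    intro k e e' he he' hee' hn'
    obtain ⟨hc, hRnd⟩ := hf.isCompl_rightOrthogonal hε hNn hfnd (range_evalAt_invariant N e)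
      (hf.restrict_range_evalAt_nondegenerate hε hN he)
    obtain ⟨hc', hRnd'⟩ := hg.isCompl_rightOrthogonal hε hMn hgnd (range_evalAt_invariant M e')
      (hg.restrict_range_evalAt_nondegenerate hε hM he')
    have hR := hf.rightOrthogonal_invariant hε hNn (range_evalAt_invariant N e)
    have hR' := hg.rightOrthogonal_invariant hε hMn (range_evalAt_invariant M e')
    obtain ⟨hUU, hUker⟩ := hf.restrict_range_equivalent hg hε hN hM he he' hee'
    have hRpow : ∀ j, N ^ j = 0 → (N.restrict hR) ^ j = 0 := fun j hj =>
      LinearMap.ext fun x => Subtype.ext (by rw [coe_restrict_pow, hj]; rfl)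
    have hRpow' : ∀ j, M ^ j = 0 → (M.restrict hR') ^ j = 0 := fun j hj =>
      LinearMap.ext fun x => Subtype.ext (by rw [coe_restrict_pow, hj]; rfl)
    have hRker : ∀ j, Module.finrank F (LinearMap.ker ((N.restrict hR) ^ j)) =
        Module.finrank F (LinearMap.ker ((M.restrict hR') ^ j)) := by
      intro j
      have h1 := finrank_ker_pow_add hc (range_evalAt_invariant N e) hR j
      have h2 := finrank_ker_pow_add hc' (range_evalAt_invariant M e') hR' j
      have h3 := hUker j
      have h4 := hker j
      omega
    refine FormsEquivalent.of_orthogonal hc hc'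
      (fun x hx y hy => mem_rightOrthogonal.mp hy x hx)
      (fun x hx y hy => hf.apply_rightOrthogonal hε hNn (range_evalAt_invariant N e) x hx y hy)
      (fun x hx y hy => mem_rightOrthogonal.mp hy x hx)
      (fun x hx y hy => hg.apply_rightOrthogonal hε hMn (range_evalAt_invariant M e') x hx y hy)
      hUU ?_
    refine ih _ ?_ rfl (hf.restrict hR) (hg.restrict hR') ⟨_, hRpow _ hN⟩ ⟨_, hRpow' _ hM⟩
      hRnd hRnd' hRker fun h2 l => ?_
    · rw [← hd, ← Submodule.finrank_add_eq_of_isCompl hc]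
      have : 0 < Module.finrank F (LinearMap.range (evalAt N e)) := by
        rw [Module.finrank_pos_iff, Submodule.nontrivial_iff_ne_bot, Submodule.ne_bot_iff]
        refine ⟨e 0, mem_range_evalAt N e 0, fun h0 => ?_⟩
        obtain ⟨c, hc⟩ := he (Pi.single 0 1) (by simp)
        apply hc
        rw [Finset.sum_eq_single 0 (fun b _ hb => by simp [Pi.single_eq_of_ne hb]) (by simp), h0]
        simp
      omega
    · rcases lt_trichotomy l n with hl | rfl | hl
      · rw [hf.isAltAt_restrict_iff hε hfnd hN he hR hl,
          hg.isAltAt_restrict_iff hε hgnd hM he' hR' hl]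
        exact halt h2 l
      · exact hn' h2 hR hR' hRker
      · exact iff_of_true
          (isAltAt_of_pow_eq_zero (hRpow _ (pow_eq_zero_of_le (by omega) hN)))
          (isAltAt_of_pow_eq_zero (hRpow' _ (pow_eq_zero_of_le (by omega) hM)))
  by_cases hfa : IsAltAt f N n
  · have hga := haltn.mp hfa
    obtain ⟨u, v, h1, h2, h3⟩ := hf.exists_hyperbolic hF hε hfnd hN hn hfa
    obtain ⟨u', v', h1', h2', h3'⟩ := hg.exists_hyperbolic hF hε hgnd hM hm hga
    refine step 1 ![u, v] ![u', v']
      (hf.isRegularFamily_pair hε hN (h2 n) (by rw [h3, if_pos rfl]))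
      (hg.isRegularFamily_pair hε hM (h2' n) (by rw [h3', if_pos rfl])) ?_
      (fun _ hR hR' _ => iff_of_true (hfa.restrict hR) (hga.restrict hR'))
    -- The pairing of v with u is recovered from that of u with v through the twisted identity.
    have hvu : ∀ l, f ((N ^ l) v) u = g ((M ^ l) v') u' := fun l => by
      have e1 := hf.apply_pow_pow_eq hg hε hN hM (u := u) (v := v) (u' := u') (v' := v')
        (fun l => by rw [h3, h3']) 0 l
      have e2 := hf.apply_pow_pow_eq hg hε hN hM (u := u) (v := v) (u' := u') (v' := v')
        (fun l => by rw [h3, h3']) 0 (l + 1)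
      rw [pow_zero, pow_zero, Module.End.one_apply, Module.End.one_apply] at e1 e2
      rw [hf u, hg u', e1, ← Module.End.mul_apply, ← Module.End.mul_apply, ← pow_succ', ← pow_succ',
        e2]
    intro a b l
    fin_cases a <;> fin_cases b
    · simp [h1, h1']
    · simp [h3, h3']
    · simpa using hvu l
    · simp [h2, h2']
  · have hga : ¬ IsAltAt g M n := fun h => hfa (haltn.mpr h)
    obtain ⟨u, u', hu, hu', huu'⟩ := hf.exists_splitters hF hg hε hfnd hgnd hN hM hfa hga
    refine step 0 (fun _ => u) (fun _ => u') (IsTwisted.isRegularFamily_singleton hu.1)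
      (IsTwisted.isRegularFamily_singleton hu'.1) (fun _ _ l => huu' l) ?_
    intro h2 hR hR' hRker
    have hdimR := hRker (n + 1)
    have hz : (N.restrict hR) ^ n = 0 ↔ (M.restrict hR') ^ n = 0 := by
      have hRpow : (N.restrict hR) ^ (n + 1) = 0 :=
        LinearMap.ext fun x => Subtype.ext (by rw [coe_restrict_pow, hN]; rfl)
      have hRpow' : (M.restrict hR') ^ (n + 1) = 0 :=
        LinearMap.ext fun x => Subtype.ext (by rw [coe_restrict_pow, hM]; rfl)
      rw [(pow_eq_zero_iff_finrank_ker _).mp hRpow, (pow_eq_zero_iff_finrank_ker _).mp hRpow']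
        at hdimR
      rw [pow_eq_zero_iff_finrank_ker, pow_eq_zero_iff_finrank_ker, hRker, hdimR]
    -- Each complement is non-alternating in degree n or has vanishing n-th power. The kernel
    -- dimensions make the powers vanish simultaneously, so the types agree.
    rcases hf.isSplitter_complement hε hfnd hN hu h2 hR with h3 | h3
    · rcases hg.isSplitter_complement hε hgnd hM hu' h2 hR' with h4 | h4
      · exact iff_of_false h3 h4
      · exact absurd (isAltAt_of_pow_eq_zero (hz.mpr h4)) h3
    · exact iff_of_true (isAltAt_of_pow_eq_zero h3) (isAltAt_of_pow_eq_zero (hz.mp h3))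

end Induction

/-! ### Reduction of a split asymmetry to nilpotent operators. -/

section Asymmetry

variable {F V : Type*} [Field F] [AddCommGroup V] [Module F V]
  {f g : LinearMap.BilinForm F V} {σ : Module.End F V}

theorem IsAsymmetry.restrict (hσ : IsAsymmetry f σ) {U : Submodule F V} (h : ∀ u ∈ U, σ u ∈ U) :
    IsAsymmetry (f.restrict U) (σ.restrict h) := fun u v => hσ u v

theorem IsAsymmetry.apply_apply (hσ : IsAsymmetry f σ) (u v : V) : f (σ u) (σ v) = f u v := by
  rw [← hσ, ← hσ]

theorem IsAsymmetry.injective (hσ : IsAsymmetry f σ) (hf : f.Nondegenerate) :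
    Function.Injective σ := by
  rw [← LinearMap.ker_eq_bot, LinearMap.ker_eq_bot']
  intro v hv
  exact hf.1 v fun u => by rw [hσ, hv, map_zero]

theorem IsAsymmetry.isTwisted (hσ : IsAsymmetry f σ) {c : F} (hc : c * c = 1) :
    IsTwisted f c (c • σ - 1) := by
  intro u v
  rw [hσ u v]
  simp only [LinearMap.sub_apply, LinearMap.smul_apply, Module.End.one_apply, map_sub, map_smul,
    smul_eq_mul]
  linear_combination -(f u (σ v)) * hc

theorem sup_maxGenEigenspace_eq_top_of_splits (h : (minpoly F σ).Splits)
    [FiniteDimensional F V] : ⨆ μ, σ.maxGenEigenspace μ = ⊤ := by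
  classical
  have key : ∀ s : Finset F, ∀ n : F → ℕ,
      LinearMap.ker (aeval σ (∏ a ∈ s, (X - C a) ^ n a)) ≤ ⨆ μ, σ.maxGenEigenspace μ := by
    intro s n
    induction s using Finset.induction_on with
    | empty => intro x hx; simp at hx; simp [hx]
    | insert a s ha ih =>
      rw [Finset.prod_insert ha, ← sup_ker_aeval_eq_ker_aeval_mul_of_coprime]
      · refine sup_le (fun x hx => ?_) ih
        refine Submodule.mem_iSup_of_mem a ((Module.End.mem_maxGenEigenspace _ _ _).mpr ⟨n a, ?_⟩)
        simpa [Algebra.algebraMap_eq_smul_one] using hx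
      · refine IsCoprime.prod_right fun b hb => IsCoprime.pow ?_
        exact isCoprime_X_sub_C_of_isUnit_sub
          (sub_ne_zero.mpr (by rintro rfl; exact ha hb)).isUnit
  rw [eq_top_iff]
  refine le_trans ?_ (key (minpoly F σ).roots.toFinset fun a => rootMultiplicity a (minpoly F σ))
  rw [← prod_multiset_root_eq_finset_root,
    ← h.eq_prod_roots_of_monic (minpoly.monic (Algebra.IsIntegral.isIntegral σ)), minpoly.aeval]
  intro x _
  simp

theorem maxGenEigenspace_eq_bot_of_not_hasEigenvalue {c : F} (h : ¬ σ.HasEigenvalue c) :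
    σ.maxGenEigenspace c = ⊥ := by
  rw [Submodule.eq_bot_iff]
  intro x hx
  obtain ⟨k, hk⟩ := (Module.End.mem_maxGenEigenspace _ _ _).mp hx
  have hinj : ∀ y, (σ - c • 1) y = 0 → y = 0 := by
    intro y hy
    by_contra hne
    refine h (Module.End.hasEigenvalue_of_hasEigenvector (x := y)
      ⟨Module.End.mem_eigenspace_iff.mpr ?_, hne⟩)
    simpa [sub_eq_zero] using hy
  clear hx
  induction k with
  | zero => simpa using hk
  | succ k ih =>
    rw [pow_succ', Module.End.mul_apply] at hk
    exact ih (hinj _ hk)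

/-- Generalized eigenspaces for eigenvalues whose product is not one are orthogonal. -/
theorem IsAsymmetry.apply_maxGenEigenspace [FiniteDimensional F V] (hσ : IsAsymmetry f σ)
    {a b : F} (hab : a * b ≠ 1) {x y : V} (hx : x ∈ σ.maxGenEigenspace a)
    (hy : y ∈ σ.maxGenEigenspace b) : f x y = 0 := by
  have hinv : ∀ w ∈ σ.maxGenEigenspace b, σ w ∈ σ.maxGenEigenspace b :=
    fun w hw => Module.End.mapsTo_maxGenEigenspace_of_comm (Commute.refl σ) b hw
  have hT : ∀ w ∈ σ.maxGenEigenspace b, (1 - a • σ) w ∈ σ.maxGenEigenspace b := fun w hw => by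
    rw [LinearMap.sub_apply, LinearMap.smul_apply]
    exact Submodule.sub_mem _ hw (Submodule.smul_mem _ _ (hinv w hw))
  -- A kernel vector would be an eigenvector for a⁻¹ ≠ b, or zero. Every y is thus (1 - aσ)w with w
  -- in the same eigenspace, and f(x, y) = f((σ - a)x, σw) lowers the nilpotency exponent of x.
  have hsurj : Function.Surjective (LinearMap.restrict (1 - a • σ) hT) := by
    rw [← LinearMap.injective_iff_surjective, ← LinearMap.ker_eq_bot, LinearMap.ker_eq_bot']
    rintro ⟨w, hw⟩ h0
    have h1 : w - a • σ w = 0 := congrArg Subtype.val h0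
    by_cases ha : a = 0
    · rw [ha, zero_smul, sub_zero] at h1
      exact Subtype.ext h1
    have h2 : σ w = a⁻¹ • w := by
      rw [sub_eq_zero] at h1
      conv_rhs => rw [h1]
      rw [smul_smul, inv_mul_cancel₀ ha, one_smul]
    have h3 : w ∈ σ.maxGenEigenspace a⁻¹ :=
      Module.End.eigenspace_le_maxGenEigenspace (Module.End.mem_eigenspace_iff.mpr h2)
    have hne : a⁻¹ ≠ b := fun h => hab (by rw [← h, mul_inv_cancel₀ ha])
    exact Subtype.ext (Submodule.disjoint_def.mp
      (Module.End.disjoint_genEigenspace σ hne ⊤ ⊤) w h3 hw)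
  obtain ⟨k, hk⟩ := (Module.End.mem_maxGenEigenspace _ _ _).mp hx
  clear hx
  induction k generalizing x y with
  | zero =>
    have : x = 0 := by simpa using hk
    rw [this, map_zero, LinearMap.zero_apply]
  | succ k ih =>
    obtain ⟨⟨w, hw⟩, hwy⟩ := hsurj ⟨y, hy⟩
    have h1 : w - a • σ w = y := congrArg Subtype.val hwy
    rw [pow_succ, Module.End.mul_apply] at hk
    have h2 := ih (hinv w hw) hk
    rw [LinearMap.sub_apply, map_sub, LinearMap.sub_apply, hσ.apply_apply] at h2
    rw [← h1, map_sub, map_smul]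
    simpa using h2

/-- Forms with the same asymmetry, all of whose eigenvalues `c` satisfy `c ^ 2 ≠ 1`, are
equivalent. -/
theorem IsAsymmetry.formsEquivalent_of_no_eigenvalue [FiniteDimensional F V]
    (hσf : IsAsymmetry f σ) (hσg : IsAsymmetry g σ)
    (hf : f.Nondegenerate) (hg : g.Nondegenerate) (htop : ⨆ μ, σ.maxGenEigenspace μ = ⊤)
    (hev : ∀ c : F, c * c = 1 → ¬ σ.HasEigenvalue c) : FormsEquivalent f g := by
  classical
  -- An arbitrary order serves only to select one member of each pair {c, c⁻¹}.
  let : LinearOrder F := linearOrderOfSTO (WellOrderingRel (α := F))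
  set P : Submodule F V := ⨆ c ∈ {c : F | c < c⁻¹}, σ.maxGenEigenspace c with hP
  set Q : Submodule F V := ⨆ c ∈ {c : F | c⁻¹ < c}, σ.maxGenEigenspace c with hQ
  have hiso : ∀ h : LinearMap.BilinForm F V, IsAsymmetry h σ → ∀ S : Set F,
      (∀ a ∈ S, ∀ b ∈ S, a * b ≠ 1) → ∀ x ∈ ⨆ c ∈ S, σ.maxGenEigenspace c,
      ∀ y ∈ ⨆ c ∈ S, σ.maxGenEigenspace c, h x y = 0 := by
    intro h hh S hS x hx y hy
    have h1 : ⨆ c ∈ S, σ.maxGenEigenspace c ≤ LinearMap.ker (h.flip y) := by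
      refine iSup₂_le fun a ha z hz => ?_
      have h2 : ⨆ c ∈ S, σ.maxGenEigenspace c ≤ LinearMap.ker (h z) :=
        iSup₂_le fun b hb w hw => hh.apply_maxGenEigenspace (hS a ha b hb) hz hw
      exact h2 hy
    exact h1 hx
  have hSP : ∀ a ∈ {c : F | c < c⁻¹}, ∀ b ∈ {c : F | c < c⁻¹}, a * b ≠ 1 := by
    intro a ha b hb hab
    rw [Set.mem_ofPred_eq] at ha hb
    rw [eq_inv_of_mul_eq_one_right hab, inv_inv] at hb
    exact lt_asymm ha hb
  have hSQ : ∀ a ∈ {c : F | c⁻¹ < c}, ∀ b ∈ {c : F | c⁻¹ < c}, a * b ≠ 1 := by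
    intro a ha b hb hab
    rw [Set.mem_ofPred_eq] at ha hb
    rw [eq_inv_of_mul_eq_one_right hab, inv_inv] at hb
    exact lt_asymm ha hb
  have hinj := hσf.injective hf
  have hsup : P ⊔ Q = ⊤ := by
    rw [eq_top_iff, ← htop]
    refine iSup_le fun c => ?_
    by_cases hc : σ.HasEigenvalue c
    · have hc0 : c ≠ 0 := by
        rintro rfl
        obtain ⟨v, hv⟩ := hc.exists_hasEigenvector
        have h1 := hv.apply_eq_smul
        rw [zero_smul] at h1
        exact hv.2 (hinj (h1.trans (map_zero σ).symm))
      have hne : c ≠ c⁻¹ := fun h => hev c (by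
        have := mul_inv_cancel₀ hc0
        rwa [← h] at this) hc
      rcases lt_or_gt_of_ne hne with h | h
      · exact le_sup_of_le_left (le_iSup₂_of_le c h le_rfl)
      · exact le_sup_of_le_right (le_iSup₂_of_le c h le_rfl)
    · rw [maxGenEigenspace_eq_bot_of_not_hasEigenvalue hc]
      exact bot_le
  have hPQ : IsCompl P Q := by
    refine ⟨Submodule.disjoint_def.mpr fun x hxP hxQ => hf.1 x fun y => ?_,
      codisjoint_iff.mpr hsup⟩
    obtain ⟨p, hp, q, hq, rfl⟩ := Submodule.mem_sup.mp (hsup ▸ Submodule.mem_top : y ∈ P ⊔ Q)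
    rw [map_add, hiso f hσf _ hSP x hxP p hp, hiso f hσf _ hSQ x hxQ q hq, add_zero]
  -- A compares the forms: f(Au, v) = g(u, v). It commutes with the common asymmetry, hence
  -- preserves P and is self-adjoint for f.
  set A : V →ₗ[F] V := LinearMap.BilinForm.symmCompOfNondegenerate g f hf with hA
  have hAl : ∀ u v, f (A u) v = g u v := fun u v =>
    LinearMap.BilinForm.symmCompOfNondegenerate_left_apply g hf v u
  have hsurj : Function.Surjective σ := LinearMap.injective_iff_surjective.mp hinj
  have hcomm : ∀ u, A (σ u) = σ (A u) := by
    intro u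
    rw [← sub_eq_zero]
    refine hf.1 _ fun v => ?_
    obtain ⟨w, rfl⟩ := hsurj v
    rw [map_sub, LinearMap.sub_apply, hAl, hσg.apply_apply, hσf.apply_apply, hAl, sub_self]
  have hAr : ∀ u v, f u (A v) = g u v := by
    intro u v
    obtain ⟨w, rfl⟩ := hsurj v
    rw [hcomm, ← hσf, hAl, hσg]
  have hAP : ∀ p ∈ P, A p ∈ P := by
    have : P ≤ P.comap A := iSup₂_le fun c hc x hx =>
      (le_iSup₂_of_le (f := fun c (_ : c ∈ {c : F | c < c⁻¹}) => σ.maxGenEigenspace c) c hc le_rfl)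
        (Module.End.mapsTo_maxGenEigenspace_of_comm
          (LinearMap.ext fun u => (hcomm u).symm : Commute σ A) c hx)
    exact this
  -- The equivalence from g to f is A on P and the identity on Q. As P and Q are totally isotropic
  -- for both forms, only the P-Q pairings matter, and there A turns f into g.
  refine (FormsEquivalent.of_linearMap hg rfl
    (LinearMap.ofIsCompl hPQ (A ∘ₗ P.subtype) Q.subtype) fun u v => ?_).symm
  obtain ⟨p, hp, q, hq, rfl⟩ := Submodule.mem_sup.mp (hsup ▸ Submodule.mem_top : u ∈ P ⊔ Q)
  obtain ⟨p', hp', q', hq', rfl⟩ := Submodule.mem_sup.mp (hsup ▸ Submodule.mem_top : v ∈ P ⊔ Q)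
  have e1 : ∀ p ∈ P, LinearMap.ofIsCompl hPQ (A ∘ₗ P.subtype) Q.subtype p = A p :=
    fun p hp => LinearMap.ofIsCompl_apply_left hPQ ⟨p, hp⟩
  have e2 : ∀ q ∈ Q, LinearMap.ofIsCompl hPQ (A ∘ₗ P.subtype) Q.subtype q = q :=
    fun q hq => LinearMap.ofIsCompl_apply_right hPQ ⟨q, hq⟩
  simp only [map_add, LinearMap.add_apply, e1 p hp, e1 p' hp', e2 q hq, e2 q' hq', hAl, hAr,
    hiso f hσf _ hSQ q hq q' hq', hiso g hσg _ hSP p hp p' hp', hiso g hσg _ hSQ q hq q' hq']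
  rw [← hAl, hiso f hσf _ hSP _ (hAP p hp) _ (hAP p' hp')]

/-- The summand belonging to an eigenvalue `c` with `c ^ 2 = 1` can be split off. -/
theorem IsAsymmetry.formsEquivalent_of_restrict [FiniteDimensional F V]
    (hF : IsQuadraticallyClosed F) (hσf : IsAsymmetry f σ) (hσg : IsAsymmetry g σ)
    (hf : f.Nondegenerate) (hg : g.Nondegenerate) {c : F} (hc : c * c = 1)
    (halt : (2 : F) = 0 → ∀ n, IsAltAt f (c • σ - 1) n ↔ IsAltAt g (c • σ - 1) n)
    (hR : ∀ (R : Submodule F V) (h : ∀ x ∈ R, σ x ∈ R), (f.restrict R).Nondegenerate →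
      (g.restrict R).Nondegenerate → ¬ Module.End.HasEigenvalue (σ.restrict h) c →
      FormsEquivalent (f.restrict R) (g.restrict R)) : FormsEquivalent f g := by
  set N : Module.End F V := c • σ - 1 with hN
  have hNf : IsTwisted f c N := hσf.isTwisted hc
  have hNg : IsTwisted g c N := hσg.isTwisted hc
  -- Fitting decomposition. The bound dim V puts every ker N^(l+1) inside ker N^n, and the extra 1
  -- ensures n ≥ 1, so that ker N lies in it too.
  obtain ⟨n, hcompl, hn⟩ := ((LinearMap.eventually_isCompl_ker_pow_range_pow N).and
    (Filter.eventually_ge_atTop (Module.finrank F V + 1))).exists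
  set K := LinearMap.ker (N ^ n) with hK
  set R := LinearMap.range (N ^ n) with hRdef
  have hNK : ∀ x ∈ K, N x ∈ K := fun x hx => by
    rw [hK, LinearMap.mem_ker] at hx ⊢
    rw [← Module.End.mul_apply, ← pow_succ, pow_succ', Module.End.mul_apply, hx, map_zero]
  have hNR : ∀ x ∈ R, N x ∈ R := by
    rintro _ ⟨y, rfl⟩
    exact ⟨N y, by rw [← Module.End.mul_apply, ← Module.End.mul_apply, ← pow_succ, pow_succ']⟩
  have hσN : ∀ x, σ x = c • (x + N x) := fun x => by
    rw [hN]
    simp [smul_smul, hc]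
  have hσR : ∀ x ∈ R, σ x ∈ R := fun x hx => by
    rw [hσN]
    exact R.smul_mem _ (R.add_mem hx (hNR x hx))
  have orth : ∀ h : LinearMap.BilinForm F V, IsTwisted h c N →
      (∀ x ∈ K, ∀ y ∈ R, h x y = 0) ∧ ∀ x ∈ R, ∀ y ∈ K, h x y = 0 := by
    intro h hh
    have h1 : ∀ x ∈ K, ∀ y ∈ R, h x y = 0 := by
      rintro x hx _ ⟨y, rfl⟩
      have := hh.apply_pow_pow_eq_zero hc hx (v := y) (j := n) (fun l hl => by
        rw [pow_apply_eq_zero_of_le hx hl, map_zero, LinearMap.zero_apply]) n 0 (by omega)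
      simpa using this
    refine ⟨h1, fun x hx y hy => ?_⟩
    rw [hh y x, h1 y hy x hx, h1 y hy _ (hNR x hx)]
    ring
  obtain ⟨hf1, hf2⟩ := orth f hNf
  obtain ⟨hg1, hg2⟩ := orth g hNg
  have hsup := hcompl.sup_eq_top
  have hsup' : R ⊔ K = ⊤ := sup_comm K R ▸ hsup
  have hnil : (N.restrict hNK) ^ n = 0 := LinearMap.ext fun x => Subtype.ext (by
    rw [coe_restrict_pow]
    exact x.2)
  refine FormsEquivalent.of_orthogonal hcompl hcompl hf1 hf2 hg1 hg2 ?_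
    (hR R hσR (restrict_nondegenerate_of_orthogonal hf hsup' hf2)
      (restrict_nondegenerate_of_orthogonal hg hsup' hg2) ?_)
  · refine IsTwisted.formsEquivalent hF hc _ rfl (hNf.restrict hNK) (hNg.restrict hNK)
      ⟨n, hnil⟩ ⟨n, hnil⟩ (restrict_nondegenerate_of_orthogonal hf hsup hf1)
      (restrict_nondegenerate_of_orthogonal hg hsup hg1) (fun _ => rfl) fun h2 l => ?_
    have key : ∀ h : LinearMap.BilinForm F V,
        IsAltAt (h.restrict K) (N.restrict hNK) l ↔ IsAltAt h N l := by
      intro h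
      refine ⟨fun hl u hu => ?_, fun hl => hl.restrict hNK⟩
      have huK : u ∈ K := by
        have h3 := Module.End.ker_pow_le_ker_pow_finrank N (l + 1) hu
        exact pow_apply_eq_zero_of_le h3 (by omega)
      have := hl ⟨u, huK⟩ (Subtype.ext (by rw [coe_restrict_pow]; exact hu))
      rwa [LinearMap.BilinForm.restrict_apply, LinearMap.domRestrict_apply, coe_restrict_pow]
        at this
    rw [key f, key g]
    exact halt h2 l
  · intro hev
    obtain ⟨⟨v, hvR⟩, hv⟩ := hev.exists_hasEigenvector
    have h1 : σ v = c • v := congrArg Subtype.val hv.apply_eq_smul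
    have h2 : N v = 0 := by
      rw [hN]
      simp [h1, smul_smul, hc]
    have h3 : v ∈ K := pow_apply_eq_zero_of_le (m := 1) (by simpa using h2) (by omega)
    exact hv.2 (Subtype.ext (Submodule.disjoint_def.mp hcompl.disjoint v h3 hvR))

/-- Non-degenerate forms with the same split asymmetry `σ` are equivalent, provided that, in
characteristic two, the forms on `ker (σ - 1)^(n+1)` are alternating simultaneously. -/
theorem IsAsymmetry.formsEquivalent [FiniteDimensional F V]
    (hF : IsQuadraticallyClosed F) (hσf : IsAsymmetry f σ) (hσg : IsAsymmetry g σ)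
    (hf : f.Nondegenerate) (hg : g.Nondegenerate) (htop : ⨆ μ, σ.maxGenEigenspace μ = ⊤)
    (halt : (2 : F) = 0 → ∀ n, IsAltAt f (σ - 1) n ↔ IsAltAt g (σ - 1) n) :
    FormsEquivalent f g := by
  refine hσf.formsEquivalent_of_restrict hF hσg hf hg (c := 1) (mul_one 1)
    (by simpa only [one_smul] using halt) fun R hR hfR hgR h1 => ?_
  have htopR : ⨆ μ, Module.End.maxGenEigenspace (σ.restrict hR) μ = ⊤ :=
    Module.End.genEigenspace_restrict_eq_top hR htop
  -- After c = 1 is split off, c = -1 remains to be treated unless the two coincide.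
  by_cases h2 : (2 : F) = 0
  · refine (hσf.restrict hR).formsEquivalent_of_no_eigenvalue (hσg.restrict hR) hfR hgR htopR
      fun c hc => ?_
    rw [eq_one_of_mul_self h2 hc]
    exact h1
  · refine (hσf.restrict hR).formsEquivalent_of_restrict hF (hσg.restrict hR) hfR hgR (c := -1)
      (by ring) (fun h => absurd h h2) fun S hS hfS hgS h3 => ?_
    refine ((hσf.restrict hR).restrict hS).formsEquivalent_of_no_eigenvalue
      ((hσg.restrict hR).restrict hS) hfS hgS
      (Module.End.genEigenspace_restrict_eq_top hS htopR) fun c hc => ?_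
    rcases mul_self_eq_one_iff.mp hc with rfl | rfl
    · intro hev
      obtain ⟨v, hv⟩ := hev.exists_hasEigenvector
      refine h1 (Module.End.hasEigenvalue_of_hasEigenvector (x := v.1)
        ⟨Module.End.mem_eigenspace_iff.mpr ?_, fun h0 => hv.2 (Subtype.ext h0)⟩)
      exact congrArg Subtype.val hv.apply_eq_smul
    · exact h3

end Asymmetry

/-! ### Free summands and elementary divisors at X - 1. -/

section Freeness

variable {F V : Type*} [Field F] [AddCommGroup V] [Module F V] {σ : Module.End F V}

theorem X_sub_one_pow_smul_of (i : ℕ) (u : V) :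
    ((X : F[X]) - 1) ^ i • Module.AEval'.of σ u = Module.AEval'.of σ (((σ - 1) ^ i) u) := by
  rw [← Module.AEval.of_aeval_smul]
  simp

theorem restrict_sub_one_pow {U : Submodule F V} (h : ∀ u ∈ U, σ u ∈ U) (i : ℕ) (u : U) :
    (((σ.restrict h - 1) ^ i) u : V) = ((σ - 1) ^ i) u := by
  have h' : ∀ u ∈ U, (σ - 1) u ∈ U := fun u hu => U.sub_mem (h u hu) hu
  exact coe_restrict_pow h' i u

/-- In F[X]/((X - 1)^m) the elements killed by (X - 1)^i are the multiples of (X - 1)^(m-i); this is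
applied coordinatewise. -/
theorem IsFreeVia.exists_eq_pow_apply {m : ℕ} {U : Submodule F V} (hU : IsFreeVia σ m U)
    {i : ℕ} (hi : i ≤ m) {u : V} (hu : u ∈ U) (h0 : ((σ - 1) ^ i) u = 0) :
    ∃ w ∈ U, u = ((σ - 1) ^ (m - i)) w := by
  obtain ⟨h, k, ⟨E⟩⟩ := hU
  set ρ : Module.End F U := σ.restrict h with hρ
  have h1 : ((X : F[X]) - 1) ^ i • E (Module.AEval'.of ρ ⟨u, hu⟩) = 0 := by
    rw [← map_smul, X_sub_one_pow_smul_of]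
    have : ((ρ - 1) ^ i) ⟨u, hu⟩ = 0 := Subtype.ext (by rw [restrict_sub_one_pow]; exact h0)
    rw [this, map_zero, map_zero]
  have h2 : ∀ a, ∃ y : F[X], E (Module.AEval'.of ρ ⟨u, hu⟩) a =
      ((X : F[X]) - 1) ^ (m - i) • Ideal.Quotient.mk (Ideal.span {((X : F[X]) - 1) ^ m}) y := by
    intro a
    obtain ⟨q, hq⟩ := Ideal.Quotient.mk_surjective (E (Module.AEval'.of ρ ⟨u, hu⟩) a)
    have h3 := congrFun h1 a
    rw [Pi.smul_apply, ← hq, Pi.zero_apply] at h3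
    change Ideal.Quotient.mk _ (((X : F[X]) - 1) ^ i * q) = 0 at h3
    rw [Ideal.Quotient.eq_zero_iff_mem, Ideal.mem_span_singleton] at h3
    have hne : ((X : F[X]) - 1) ^ i ≠ 0 := pow_ne_zero _ (X_sub_C_ne_zero (1 : F))
    have h4 : ((X : F[X]) - 1) ^ (m - i) ∣ q := by
      rw [show m = i + (m - i) by omega, pow_add] at h3
      exact (mul_dvd_mul_iff_left hne).mp h3
    obtain ⟨y, rfl⟩ := h4
    exact ⟨y, by rw [← hq]; rfl⟩
  choose y hy using h2
  set w : U := (Module.AEval'.of ρ).symm (E.symm fun a => Ideal.Quotient.mk _ (y a)) with hw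
  refine ⟨w, w.2, ?_⟩
  rw [← restrict_sub_one_pow h]
  have : (⟨u, hu⟩ : U) = ((ρ - 1) ^ (m - i)) w := by
    apply (Module.AEval'.of ρ).injective
    rw [← X_sub_one_pow_smul_of, hw, LinearEquiv.apply_symm_apply]
    apply E.injective
    rw [map_smul, LinearEquiv.apply_symm_apply]
    exact funext hy
  exact congrArg Subtype.val this

/-- The substitution X ↦ X + 1 passes between the module structures given by σ and by σ - 1. -/
theorem evalAt_sub_one {k : ℕ} (e : Fin k → V) (p : Fin k → F[X]) :
    evalAt σ e p = evalAt (σ - 1) e (fun a => (p a).comp (X + 1)) := by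
  rw [evalAt_apply, evalAt_apply]
  refine Finset.sum_congr rfl fun a _ => ?_
  rw [aeval_comp]
  simp

theorem X_pow_dvd_comp_iff (m : ℕ) (p : F[X]) :
    X ^ m ∣ p.comp (X + 1) ↔ (X - 1) ^ m ∣ p := by
  constructor
  · rintro ⟨q, hq⟩
    refine ⟨q.comp (X - 1), ?_⟩
    have := congrArg (fun r : F[X] => r.comp (X - 1)) hq
    simpa [comp_assoc] using this
  · rintro ⟨q, rfl⟩
    exact ⟨q.comp (X + 1), by simp⟩

theorem isFreeVia_range_evalAt {k m : ℕ} {e : Fin k → V}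
    (he : ∀ p : Fin k → F[X], evalAt (σ - 1) e p = 0 ↔ ∀ a, X ^ m ∣ p a) :
    IsFreeVia σ m (LinearMap.range (evalAt (σ - 1) e)) := by
  classical
  set U := LinearMap.range (evalAt (σ - 1) e) with hUdef
  have h : ∀ u ∈ U, σ u ∈ U := fun u hu => by
    have := U.add_mem (range_evalAt_invariant (σ - 1) e u hu) hu
    simpa using this
  set ρ : Module.End F U := σ.restrict h with hρ
  let φ : (Fin k → F[X]) →ₗ[F[X]] Module.AEval' ρ :=
    Fintype.linearCombination F[X] fun a =>
      Module.AEval'.of ρ ⟨e a, mem_range_evalAt (σ - 1) e a⟩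
  have haev : ∀ (q : F[X]) (u : U), ((aeval ρ q u : U) : V) = aeval σ q u := by
    intro q u
    induction q using Polynomial.induction_on' with
    | add p q hp hq => simp [hp, hq]
    | monomial n c => simp [aeval_monomial, ← coe_restrict_pow h, hρ]
  have hφ : ∀ p, (((Module.AEval'.of ρ).symm (φ p) : U) : V) = evalAt σ e p := by
    intro p
    rw [evalAt_apply]
    simp only [φ, Fintype.linearCombination_apply, map_sum, Submodule.coe_sum]
    refine Finset.sum_congr rfl fun a _ => ?_
    rw [← Module.AEval.of_aeval_smul]
    exact haev (p a) _
  have hker : LinearMap.ker φ =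
      Submodule.pi Set.univ fun _ : Fin k => Ideal.span {((X : F[X]) - 1) ^ m} := by
    ext p
    rw [LinearMap.mem_ker, ← (Module.AEval'.of ρ).symm.map_eq_zero_iff, ← Submodule.coe_eq_zero,
      hφ, evalAt_sub_one, he]
    simp [X_pow_dvd_comp_iff, Submodule.mem_pi, Ideal.mem_span_singleton]
  have hsurj : Function.Surjective φ := by
    intro x
    obtain ⟨p, hp⟩ := ((Module.AEval'.of ρ).symm x).2
    refine ⟨fun a => (p a).comp (X - 1), ?_⟩
    apply (Module.AEval'.of ρ).symm.injective
    apply Subtype.ext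
    rw [hφ, evalAt_sub_one, ← hp]
    congr 1
    funext a
    simp [comp_assoc]
  exact ⟨h, k, ⟨(φ.quotKerEquivOfSurjective hsurj).symm ≪≫ₗ
    Submodule.quotEquivOfEq _ _ hker ≪≫ₗ Submodule.quotientPi _⟩⟩

/-- Every vector of `ker (σ - 1)^(n+1)` is the sum of one in `ker (σ - 1)^n` and one in
`(σ - 1) ker (σ - 1)^(n+2)`; equivalently, there is no Jordan block of size `n + 1`. -/
def HasNoBlock (N : Module.End F V) (n : ℕ) : Prop :=
  ∀ u, (N ^ (n + 1)) u = 0 → ∃ b w, (N ^ n) b = 0 ∧ (N ^ (n + 2)) w = 0 ∧ u = b + N w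

theorem exists_elementaryDivisors [FiniteDimensional F V] (σ : Module.End F V) :
    ∃ (k : ℕ) (p : Fin k → F[X]) (e : Fin k → ℕ),
      (∀ i, (p i).Monic ∧ Irreducible (p i) ∧ 1 ≤ e i) ∧
      Nonempty (Module.AEval' σ ≃ₗ[F[X]]
        DirectSum (Fin k) (fun i => F[X] ⧸ Ideal.span {p i ^ e i})) := by
  classical
  obtain ⟨ι, _, p, hp, e, ⟨E⟩⟩ := Module.equiv_directSum_of_isTorsion
    (Module.AEval.isTorsion_of_finiteDimensional F V σ)
  -- The structure theorem may produce trivial summands of exponent zero and non-monic primes: the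
  -- former are discarded, the latter normalized.
  let ψ := Fintype.equivFin {i // e i ≠ 0}
  have hspan : ∀ i, Submodule.span F[X] {p i ^ e i} = Ideal.span {normalize (p i) ^ e i} :=
    fun i => Ideal.span_singleton_eq_span_singleton.mpr
      ((associated_normalize (p i)).pow_pow)
  let θ : (∀ i, F[X] ⧸ Submodule.span F[X] {p i ^ e i}) →ₗ[F[X]]
      ∀ a, F[X] ⧸ Ideal.span {normalize (p (ψ.symm a)) ^ e (ψ.symm a)} :=
    LinearMap.pi fun a => (Submodule.quotEquivOfEq _ _ (hspan (ψ.symm a))).toLinearMap ∘ₗ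
      LinearMap.proj (ψ.symm a).1
  have hθ : Function.Bijective θ := by
    constructor
    · rw [← LinearMap.ker_eq_bot, LinearMap.ker_eq_bot']
      intro x hx
      funext i
      by_cases hi : e i = 0
      · obtain ⟨q, hq⟩ := Submodule.Quotient.mk_surjective _ (x i)
        rw [← hq, Pi.zero_apply, Submodule.Quotient.mk_eq_zero, hi, pow_zero]
        exact Ideal.mem_span_singleton.mpr (one_dvd q)
      · have h1 := congrFun hx (ψ ⟨i, hi⟩)
        simp only [θ, LinearMap.pi_apply, LinearMap.comp_apply, LinearMap.proj_apply,
          LinearEquiv.coe_coe, Pi.zero_apply, LinearEquiv.map_eq_zero_iff] at h1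
        rw [Equiv.symm_apply_apply] at h1
        exact h1
    · intro y
      choose q hq using fun a => Submodule.Quotient.mk_surjective _ (y a)
      refine ⟨fun i => Submodule.Quotient.mk (if hi : e i ≠ 0 then q (ψ ⟨i, hi⟩) else 0), ?_⟩
      funext a
      rw [← hq a]
      change Submodule.Quotient.mk _ = _
      congr 1
      rw [dif_pos (ψ.symm a).2]
      exact congrArg q (ψ.apply_symm_apply a)
  refine ⟨_, fun a => normalize (p (ψ.symm a)), fun a => e (ψ.symm a), fun a => ⟨?_, ?_, ?_⟩,
    ⟨E ≪≫ₗ DirectSum.linearEquivFunOnFintype F[X] ι _ ≪≫ₗ LinearEquiv.ofBijective θ hθ ≪≫ₗ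
      (DirectSum.linearEquivFunOnFintype F[X] _ _).symm⟩⟩
  · exact Polynomial.monic_normalize (hp _).ne_zero
  · exact ((associated_normalize _).irreducible_iff).mp (hp _)
  · exact Nat.one_le_iff_ne_zero.mpr (ψ.symm a).2

theorem hasNoBlock_of_not_isElementaryDivisor [FiniteDimensional F V] {n : ℕ}
    (h : ¬ IsElementaryDivisor σ ((X - 1) ^ (n + 1))) : HasNoBlock (σ - 1) n := by
  obtain ⟨k, p, e, hpe, ⟨E⟩⟩ := exists_elementaryDivisors σ
  have hne : ∀ i, p i ^ e i ≠ (X - 1) ^ (n + 1) := fun i hi => h ⟨k, p, e, hpe, ⟨E⟩, i, hi⟩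
  let E' := E ≪≫ₗ DirectSum.linearEquivFunOnFintype F[X] (Fin k)
    (fun i => F[X] ⧸ Ideal.span {p i ^ e i})
  have hX : (X - 1 : F[X]) = X - C 1 := by simp
  have hirr : Irreducible (X - 1 : F[X]) := hX ▸ irreducible_X_sub_C (1 : F)
  have hmon : (X - 1 : F[X]).Monic := hX ▸ monic_X_sub_C (1 : F)
  intro u hu
  set x := E' (Module.AEval'.of σ u) with hx
  have hx0 : ((X : F[X]) - 1) ^ (n + 1) • x = 0 := by
    rw [hx, ← map_smul, X_sub_one_pow_smul_of, hu, map_zero, map_zero]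
  -- In one cyclic summand: a block of size at most n at X - 1 lies in the kernel of the n-th power;
  -- in a block of size at least n + 2 the element is (X - 1) times one killed by (X - 1)^(n+2); at
  -- any other prime it is zero.
  have key : ∀ i, ∃ b w : F[X], x i = Ideal.Quotient.mk _ (b + (X - 1) * w) ∧
      p i ^ e i ∣ (X - 1) ^ n * b ∧ p i ^ e i ∣ (X - 1) ^ (n + 2) * w := by
    intro i
    obtain ⟨q, hq⟩ := Ideal.Quotient.mk_surjective (x i)
    have h3 := congrFun hx0 i
    rw [Pi.smul_apply, ← hq, Pi.zero_apply] at h3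
    change Ideal.Quotient.mk _ (((X : F[X]) - 1) ^ (n + 1) * q) = 0 at h3
    rw [Ideal.Quotient.eq_zero_iff_mem, Ideal.mem_span_singleton] at h3
    suffices hq' : ∃ b w : F[X], q = b + (X - 1) * w ∧
        p i ^ e i ∣ (X - 1) ^ n * b ∧ p i ^ e i ∣ (X - 1) ^ (n + 2) * w by
      obtain ⟨b, w, rfl, h1⟩ := hq'
      exact ⟨b, w, hq.symm, h1⟩
    by_cases hpi : p i = X - 1
    · have hen : e i ≠ n + 1 := fun hen => hne i (by rw [hpi, hen])
      rw [hpi] at h3 ⊢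
      rcases Nat.lt_or_ge (e i) (n + 1) with hlt | hge
      · exact ⟨q, 0, by simp, Dvd.dvd.mul_right (pow_dvd_pow _ (by omega)) _, by simp⟩
      · obtain ⟨d, hd⟩ : ∃ d, e i = (n + 1) + (d + 1) := ⟨e i - n - 2, by omega⟩
        rw [hd, pow_add] at h3
        obtain ⟨w, rfl⟩ := (mul_dvd_mul_iff_left (pow_ne_zero _ hirr.ne_zero)).mp h3
        refine ⟨0, (X - 1) ^ d * w, ?_, by simp, ?_⟩
        · rw [zero_add, pow_succ', mul_assoc]
        · rw [hd, ← mul_assoc, ← pow_add]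
          exact Dvd.intro w (by ring)
    · have hcop : IsCoprime (p i ^ e i) ((X - 1) ^ (n + 1)) := by
        refine IsCoprime.pow ((hpe i).2.1.coprime_iff_not_dvd.mpr fun hdvd => hpi ?_)
        exact Polynomial.eq_of_monic_of_associated (hpe i).1 hmon
          ((hpe i).2.1.associated_of_dvd hirr hdvd)
      have h4 := hcop.dvd_of_dvd_mul_left h3
      exact ⟨q, 0, by simp, h4.mul_left _, by simp⟩
  choose b w h1 h2 h3 using key
  have hof : ∀ y, ∃ v, E' (Module.AEval'.of σ v) = y := fun y =>
    ⟨(Module.AEval'.of σ).symm (E'.symm y), by simp⟩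
  obtain ⟨v₁, hv₁⟩ := hof fun i => Ideal.Quotient.mk _ (b i)
  obtain ⟨v₂, hv₂⟩ := hof fun i => Ideal.Quotient.mk _ (w i)
  have hinj : ∀ v, E' (Module.AEval'.of σ v) = 0 → v = 0 := fun v hv => by
    simpa using hv
  refine ⟨v₁, v₂, hinj _ ?_, hinj _ ?_, ?_⟩
  · rw [← X_sub_one_pow_smul_of, map_smul, hv₁]
    exact funext fun i => Ideal.Quotient.eq_zero_iff_mem.mpr (Ideal.mem_span_singleton.mpr (h2 i))
  · rw [← X_sub_one_pow_smul_of, map_smul, hv₂]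
    exact funext fun i => Ideal.Quotient.eq_zero_iff_mem.mpr (Ideal.mem_span_singleton.mpr (h3 i))
  · rw [← sub_eq_zero]
    apply hinj
    have h4 := X_sub_one_pow_smul_of (σ := σ) 1 v₂
    rw [pow_one, pow_one] at h4
    rw [map_sub, map_sub, map_add, map_add, ← h4, map_smul, hv₁, hv₂, sub_eq_zero]
    exact funext h1

end Freeness

/-! ### Existence of orthogonal decompositions into free summands. -/

section Decomposition

variable {F : Type*} [Field F]

/-- The radical of f(N^n ·, ·) is ker N^n, so a basis of a linear complement of ker N^n is regular.
A vector orthogonal to its F[N]-span lies in that radical. -/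
theorem IsTwisted.exists_regular_generators {V : Type*} [AddCommGroup V] [Module F V]
    [FiniteDimensional F V] {f : LinearMap.BilinForm F V} {ε : F} {N : Module.End F V} {n : ℕ}
    (hf : IsTwisted f ε N) (hε : ε * ε = 1) (hnd : f.Nondegenerate) (hN : N ^ (n + 1) = 0) :
    ∃ (k : ℕ) (e : Fin k → V), IsRegularFamily f N n e ∧
      ∀ r ∈ rightOrthogonal f (LinearMap.range (evalAt N e)), (N ^ n) r = 0 := by
  obtain ⟨L, hL⟩ := Submodule.exists_isCompl (LinearMap.ker (N ^ n))
  let B := Module.finBasis F L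
  have hdecomp : ∀ y, ∃ a ∈ LinearMap.ker (N ^ n), ∃ l ∈ L, a + l = y := fun y =>
    Submodule.mem_sup.mp (hL.sup_eq_top ▸ Submodule.mem_top)
  have hcomm := hf.apply_pow_top_comm hε hN
  have hsum : ∀ l : L, (l : V) = ∑ i, B.repr l i • (B i : V) := fun l => by
    have := congrArg L.subtype (B.sum_repr l)
    rw [map_sum] at this
    exact this.symm
  refine ⟨_, fun a => (B a : V), ?_, ?_⟩
  · intro x hx
    have hw : (∑ a, x a • (B a : V)) = ((∑ a, x a • B a : L) : V) := by simp
    rw [hw]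
    set w : L := ∑ a, x a • B a with hwdef
    have hw0 : w ≠ 0 := fun h0 => hx (funext
      (Fintype.linearIndependent_iff.mp B.linearIndependent x h0))
    have hNw : (N ^ n) (w : V) ≠ 0 := fun h0 => hw0 (Subtype.ext
      (Submodule.disjoint_def.mp hL.disjoint _ h0 w.2))
    by_contra! hcon
    refine hNw (hnd.1 _ fun y => ?_)
    obtain ⟨a, ha, l, hl, rfl⟩ := hdecomp y
    rw [map_add, hcomm a, LinearMap.mem_ker.mp ha, map_zero, LinearMap.zero_apply, mul_zero,
      zero_add]
    rw [show l = _ from hsum ⟨l, hl⟩, map_sum]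
    exact Finset.sum_eq_zero fun i _ => by rw [map_smul, hcon, smul_zero]
  · intro r hr
    refine hnd.1 _ fun y => ?_
    obtain ⟨a, ha, l, hl, rfl⟩ := hdecomp y
    have hl' : l ∈ LinearMap.range (evalAt N fun a => (B a : V)) := by
      rw [show l = _ from hsum ⟨l, hl⟩]
      exact Submodule.sum_mem _ fun i _ => Submodule.smul_mem _ _ (mem_range_evalAt N _ i)
    rw [hcomm (a + l), map_add, LinearMap.mem_ker.mp ha, zero_add,
      mem_rightOrthogonal.mp hr _ (pow_mem_of_invariant (range_evalAt_invariant N _) n hl'),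
      mul_zero]

theorem evalAt_coe {V : Type*} [AddCommGroup V] [Module F V] {N : Module.End F V}
    {U : Submodule F V} (h : ∀ u ∈ U, N u ∈ U) {k : ℕ} (e : Fin k → U) (p : Fin k → F[X]) :
    evalAt N (fun a => (e a : V)) p = (evalAt (N.restrict h) e p : V) := by
  have haev : ∀ (q : F[X]) (u : U), ((aeval (N.restrict h) q u : U) : V) = aeval N q u := by
    intro q u
    induction q using Polynomial.induction_on' with
    | add p q hp hq => simp [hp, hq]
    | monomial n c => simp [aeval_monomial, ← coe_restrict_pow h]
  simp [evalAt_apply, haev]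

/-- A non-degenerate twisted form with nilpotent operator is an orthogonal sum of free pieces. -/
theorem IsTwisted.exists_decomposition {ε : F} (hε : ε * ε = 1) (r : ℕ) :
    ∀ {V : Type*} [AddCommGroup V] [Module F V] [FiniteDimensional F V]
      {f : LinearMap.BilinForm F V} {N : Module.End F V},
      IsTwisted f ε N → f.Nondegenerate → N ^ r = 0 →
      ∃ U : Fin r → Submodule F V, iSup U = ⊤ ∧
        (∀ i j, i ≠ j → ∀ u ∈ U i, ∀ v ∈ U j, f u v = 0) ∧
        ∀ i, ∃ (k : ℕ) (e : Fin k → V), U i = LinearMap.range (evalAt N e) ∧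
          ∀ p, evalAt N e p = 0 ↔ ∀ a, X ^ (i + 1 : ℕ) ∣ p a := by
  induction r with
  | zero =>
    intro V _ _ _ f N _ _ h0
    refine ⟨Fin.elim0, ?_, fun i => i.elim0, fun i => i.elim0⟩
    rw [eq_top_iff]
    intro x _
    have : x = 0 := LinearMap.congr_fun h0 x
    rw [this]
    exact Submodule.zero_mem _
  | succ n ih =>
    intro V _ _ _ f N hf hnd hN
    obtain ⟨k, e, he, hr⟩ := hf.exists_regular_generators hε hnd hN
    set T := LinearMap.range (evalAt N e) with hT
    set R := rightOrthogonal f T with hRdef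
    have hTN : ∀ u ∈ T, N u ∈ T := range_evalAt_invariant N e
    have hR : ∀ u ∈ R, N u ∈ R := hf.rightOrthogonal_invariant hε ⟨_, hN⟩ hTN
    obtain ⟨hc, hRnd⟩ := hf.isCompl_rightOrthogonal hε ⟨_, hN⟩ hnd hTN
      (hf.restrict_range_evalAt_nondegenerate hε hN he)
    have hRT := hf.apply_rightOrthogonal hε ⟨_, hN⟩ hTN
    obtain ⟨U, hU1, hU2, hU3⟩ := ih (hf.restrict hR) hRnd (LinearMap.ext fun x => Subtype.ext (by
      rw [coe_restrict_pow]; exact hr x x.2))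
    have hmem : ∀ i, ∀ x ∈ (U i).map R.subtype, x ∈ R := by
      rintro i _ ⟨x, -, rfl⟩
      exact x.2
    -- The last index carries the blocks of size n + 1. On the complement N^n = 0, so the induction
    -- hypothesis supplies the others.
    refine ⟨Fin.snoc (α := fun _ => Submodule F V) (fun i => (U i).map R.subtype) T, ?_, ?_, ?_⟩
    · rw [eq_top_iff, ← hc.sup_eq_top]
      refine sup_le ?_ ?_
      · refine le_iSup_of_le (Fin.last n) ?_
        rw [Fin.snoc_last]
      · have h1 : R = (⨆ i, U i).map R.subtype := by
          rw [hU1, Submodule.map_top, Submodule.range_subtype]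
        refine h1.le.trans ?_
        rw [Submodule.map_iSup]
        refine iSup_le fun i => le_iSup_of_le i.castSucc ?_
        rw [Fin.snoc_castSucc]
    · intro i j hij
      induction i using Fin.lastCases with
      | last =>
        induction j using Fin.lastCases with
        | last => exact absurd rfl hij
        | cast j =>
          rw [Fin.snoc_last, Fin.snoc_castSucc]
          exact fun u hu v hv => mem_rightOrthogonal.mp (hmem j v hv) u hu
      | cast i =>
        induction j using Fin.lastCases with
        | last =>
          rw [Fin.snoc_last, Fin.snoc_castSucc]
          exact fun u hu v hv => hRT u (hmem i u hu) v hv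
        | cast j =>
          rw [Fin.snoc_castSucc, Fin.snoc_castSucc]
          rintro _ ⟨u, hu, rfl⟩ _ ⟨v, hv, rfl⟩
          exact hU2 i j (fun h => hij (by rw [h])) u hu v hv
    · intro i
      induction i using Fin.lastCases with
      | last =>
        refine ⟨k, e, by rw [Fin.snoc_last], fun p => ?_⟩
        rw [Fin.val_last]
        exact hf.evalAt_eq_zero_iff hε hN he
      | cast i =>
        obtain ⟨k', e', h1, h2⟩ := hU3 i
        refine ⟨k', fun a => (e' a : V), ?_, fun p => ?_⟩
        · rw [Fin.snoc_castSucc, h1]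
          ext x
          constructor
          · rintro ⟨_, ⟨p, rfl⟩, rfl⟩
            exact ⟨p, evalAt_coe hR e' p⟩
          · rintro ⟨p, rfl⟩
            exact ⟨_, ⟨p, rfl⟩, (evalAt_coe hR e' p).symm⟩
        · rw [evalAt_coe hR, Submodule.coe_eq_zero, h2, Fin.val_castSucc]

variable {V : Type*} [AddCommGroup V] [Module F V] {f g : LinearMap.BilinForm F V}
  {σ τ : Module.End F V}

theorem maxGenEigenspace_one_eq [FiniteDimensional F V] {n : ℕ} (hn : Module.finrank F V ≤ n) :
    σ.maxGenEigenspace 1 = LinearMap.ker ((σ - 1) ^ n) := by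
  ext x
  rw [Module.End.mem_maxGenEigenspace, one_smul]
  refine ⟨?_, fun h => ⟨n, h⟩⟩
  rintro ⟨k, hk⟩
  exact pow_apply_eq_zero_of_le (Module.End.ker_pow_le_ker_pow_finrank (σ - 1) k hk) hn

theorem IsAsymmetry.isTwisted_sub_one (hσ : IsAsymmetry f σ) : IsTwisted f 1 (σ - 1) := by
  simpa using hσ.isTwisted (mul_one 1)

/-- A vector killed by a power of `σ - 1` which is orthogonal to the generalized `1`-eigenspace
is zero. -/
theorem IsAsymmetry.eq_zero_of_orthogonal [FiniteDimensional F V] (hσ : IsAsymmetry f σ)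
    (hf : f.Nondegenerate) {x : V} (hx : x ∈ σ.maxGenEigenspace 1)
    (h : ∀ y ∈ σ.maxGenEigenspace 1, f x y = 0) : x = 0 := by
  obtain ⟨n, hcompl, hn⟩ := ((LinearMap.eventually_isCompl_ker_pow_range_pow (σ - 1)).and
    (Filter.eventually_ge_atTop (Module.finrank F V))).exists
  rw [maxGenEigenspace_one_eq hn] at hx h
  refine hf.1 x fun y => ?_
  obtain ⟨a, ha, _, ⟨b, rfl⟩, rfl⟩ := Submodule.mem_sup.mp
    (hcompl.sup_eq_top ▸ Submodule.mem_top : y ∈ _ ⊔ _)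
  have := hσ.isTwisted_sub_one.apply_pow_pow_eq_zero (mul_one 1) hx (v := b) (j := n)
    (fun l hl => by rw [pow_apply_eq_zero_of_le hx hl, map_zero, LinearMap.zero_apply]) n 0
    (by omega)
  rw [map_add, h a ha, zero_add]
  simpa using this

theorem IsAsymmetry.exists_isOrthogonalDecomposition [FiniteDimensional F V]
    (hσ : IsAsymmetry f σ) (hf : f.Nondegenerate) {r : ℕ} (hr : Module.finrank F V ≤ r) :
    ∃ U : Fin r → Submodule F V, IsOrthogonalDecomposition f σ r U := by
  set K := σ.maxGenEigenspace 1 with hK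
  have hNK : ∀ x ∈ K, (σ - 1) x ∈ K := fun x hx =>
    Module.End.mapsTo_maxGenEigenspace_of_comm (by simp) 1 hx
  have hKnd : (f.restrict K).Nondegenerate := nondegenerate_of_left fun x hx =>
    Subtype.ext (hσ.eq_zero_of_orthogonal hf x.2 fun y hy => hx ⟨y, hy⟩)
  have hKr : ((σ - 1).restrict hNK) ^ r = 0 := LinearMap.ext fun x => Subtype.ext (by
    rw [coe_restrict_pow]
    exact (maxGenEigenspace_one_eq hr).le x.2)
  obtain ⟨U, h1, h2, h3⟩ := IsTwisted.exists_decomposition (mul_one 1) r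
    (hσ.isTwisted_sub_one.restrict hNK) hKnd hKr
  have hsup : ⨆ i, (U i).map K.subtype = K := by
    rw [← Submodule.map_iSup, h1, Submodule.map_top, Submodule.range_subtype]
  have horth : ∀ i j, i ≠ j → ∀ u ∈ (U i).map K.subtype, ∀ v ∈ (U j).map K.subtype,
      f u v = 0 := by
    rintro i j hij _ ⟨u, hu, rfl⟩ _ ⟨v, hv, rfl⟩
    exact h2 i j hij u hu v hv
  refine ⟨fun i => (U i).map K.subtype, ?_, hsup, horth, ?_⟩
  · intro i
    rw [Submodule.disjoint_def]
    intro x hx hx'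
    have hxK : x ∈ K := by
      obtain ⟨y, -, rfl⟩ := hx
      exact y.2
    -- A vector of U_i lying also in the sum of the other summands is orthogonal to every U_j,
    -- including U_i itself.
    refine hσ.eq_zero_of_orthogonal hf hxK ?_
    have h4 : ⨆ j, (U j).map K.subtype ≤ LinearMap.ker (f x) := by
      refine iSup_le fun j y hy => ?_
      by_cases hij : i = j
      · subst hij
        have h5 : ⨆ (j) (_ : j ≠ i), (U j).map K.subtype ≤ LinearMap.ker (f.flip y) :=
          iSup₂_le fun j hj z hz => horth j i hj z hz y hy
        exact h5 hx'
      · exact horth i j hij x hx y hy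
    rw [hsup] at h4
    exact h4
  · intro i
    obtain ⟨k, e, h4, h5⟩ := h3 i
    have h6 : (U i).map K.subtype = LinearMap.range (evalAt (σ - 1) fun a => (e a : V)) := by
      rw [h4]
      ext x
      constructor
      · rintro ⟨_, ⟨p, rfl⟩, rfl⟩
        exact ⟨p, evalAt_coe hNK e p⟩
      · rintro ⟨p, rfl⟩
        exact ⟨_, ⟨p, rfl⟩, (evalAt_coe hNK e p).symm⟩
    change IsFreeVia σ (i + 1) ((U i).map K.subtype)
    rw [h6]
    refine isFreeVia_range_evalAt fun p => ?_
    rw [evalAt_coe hNK, Submodule.coe_eq_zero, h5]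

end Decomposition

/-! ### The induced forms and the alternating types. -/

section Invariants

variable {F V : Type*} [Field F] [AddCommGroup V] [Module F V]
  {f g : LinearMap.BilinForm F V} {σ τ : Module.End F V}

/-- Moving N^l from x to y never lowers the power, so f(y, N^l x) = 0 for l ≥ j; the twisted
identity exchanges the arguments. -/
theorem IsTwisted.apply_pow_left_eq_zero_of_pow {ε : F} {N : Module.End F V}
    (hf : IsTwisted f ε N) (hε : ε * ε = 1) {j : ℕ} {y : V} (hy : (N ^ j) y = 0) (x : V) :
    f ((N ^ j) x) y = 0 := by
  have h : ∀ l, j ≤ l → f y ((N ^ l) x) = 0 := fun l hl => by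
    have := hf.apply_pow_pow_eq_zero hε hy (v := x) (j := l) (fun i hi => by
      rw [pow_apply_eq_zero_of_le hy (by omega), map_zero, LinearMap.zero_apply]) l 0 (by omega)
    simpa using this
  rw [hf y, h j le_rfl, ← Module.End.mul_apply, ← pow_succ', h (j + 1) (by omega)]
  ring

/-- For u = b + Nw with N^n b = 0 the value is f(N^(n+1) w, u), which vanishes because N^(n+1) u =
0. -/
theorem HasNoBlock.isAltAt {ε : F} {N : Module.End F V} (hf : IsTwisted f ε N)
    (hε : ε * ε = 1) {n : ℕ} (h : HasNoBlock N n) : IsAltAt f N n := by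
  intro u hu
  obtain ⟨b, w, hb, -, rfl⟩ := h u hu
  have h1 : (N ^ n) (b + N w) = (N ^ (n + 1)) w := by
    rw [map_add, hb, zero_add, ← Module.End.mul_apply, ← pow_succ]
  rw [h1]
  exact hf.apply_pow_left_eq_zero_of_pow hε hu w

theorem FormsEquivalent.isAltAt_iff {W : Type*} [AddCommGroup W] [Module F W]
    {g : LinearMap.BilinForm F W} {N : Module.End F V} {M : Module.End F W}
    (x : V ≃ₗ[F] W) (hx : ∀ u v, g (x u) (x v) = f u v) (hNM : ∀ u, x (N u) = M (x u)) (n : ℕ) :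
    IsAltAt f N n ↔ IsAltAt g M n := by
  have hpow : ∀ j u, x ((N ^ j) u) = (M ^ j) (x u) := by
    intro j
    induction j with
    | zero => intro u; rfl
    | succ j ih =>
      intro u
      rw [pow_succ, pow_succ, Module.End.mul_apply, Module.End.mul_apply, ih, hNM]
  constructor
  · intro h w hw
    obtain ⟨u, rfl⟩ := x.surjective w
    rw [← hpow, hx]
    rw [← hpow, x.map_eq_zero_iff] at hw
    exact h u hw
  · intro h u hu
    rw [← hx, hpow]
    exact h _ (by rw [← hpow, hu, map_zero])

theorem HasNoBlock.of_conj {N M : Module.End F V} (x : V ≃ₗ[F] V)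
    (hNM : ∀ u, x (N u) = M (x u)) {n : ℕ} (h : HasNoBlock N n) : HasNoBlock M n := by
  have hpow : ∀ j u, x ((N ^ j) u) = (M ^ j) (x u) := by
    intro j
    induction j with
    | zero => intro u; rfl
    | succ j ih =>
      intro u
      rw [pow_succ, pow_succ, Module.End.mul_apply, Module.End.mul_apply, ih, hNM]
  intro w hw
  obtain ⟨u, rfl⟩ := x.surjective w
  rw [← hpow, x.map_eq_zero_iff] at hw
  obtain ⟨b, w, h1, h2, rfl⟩ := h u hw
  exact ⟨x b, x w, by rw [← hpow, h1, map_zero], by rw [← hpow, h2, map_zero],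
    by rw [map_add, hNM]⟩

variable {r : ℕ} {U : Fin r → Submodule F V}

theorem IsOrthogonalDecomposition.exists_components (hU : IsOrthogonalDecomposition f σ r U)
    {j : ℕ} {u : V} (hu : ((σ - 1) ^ j) u = 0) :
    ∃ x : Fin r → V, (∀ i, x i ∈ U i) ∧ (∀ i, ((σ - 1) ^ j) (x i) = 0) ∧ ∑ i, x i = u := by
  have hmem : u ∈ iSup U := by
    rw [hU.iSup_eq, Module.End.mem_maxGenEigenspace, one_smul]
    exact ⟨j, hu⟩
  obtain ⟨x, hx, hsum⟩ := (Submodule.mem_iSup_iff_exists_finsupp U u).mp hmem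
  rw [Finsupp.sum_fintype _ _ (fun _ => rfl)] at hsum
  refine ⟨x, hx, fun i => ?_, hsum⟩
  have hinv : ∀ i, ((σ - 1) ^ j) (x i) ∈ U i := fun i => by
    obtain ⟨h, -⟩ := hU.free i
    exact pow_mem_of_invariant (fun u hu => (U i).sub_mem (h u hu) hu) j (hx i)
  refine Submodule.disjoint_def.mp (hU.independent i) _ (hinv i) ?_
  have h1 : ((σ - 1) ^ j) (x i) = - ∑ k ∈ Finset.univ.erase i, ((σ - 1) ^ j) (x k) := by
    rw [eq_neg_iff_add_eq_zero,
      Finset.add_sum_erase _ (fun k => ((σ - 1) ^ j) (x k)) (Finset.mem_univ i), ← map_sum, hsum, hu]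
  rw [h1]
  refine Submodule.neg_mem _ (Submodule.sum_mem _ fun k hk => ?_)
  exact le_iSup₂_of_le (f := fun j (_ : j ≠ i) => U j) k (Finset.ne_of_mem_erase hk) le_rfl (hinv k)

/-- Components in smaller blocks lie in ker (σ - 1)^i. In a larger block, freeness writes the
component as a positive power of σ - 1 applied to a vector. Only U_i, of block size i + 1, is left
over. -/
theorem IsOrthogonalDecomposition.exists_add_add (hU : IsOrthogonalDecomposition f σ r U)
    (i : Fin r) {u : V} (hu : ((σ - 1) ^ (i + 1 : ℕ)) u = 0) :
    ∃ a ∈ U i, ∃ b w, ((σ - 1) ^ (i : ℕ)) b = 0 ∧ ((σ - 1) ^ (i + 2 : ℕ)) w = 0 ∧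
      u = a + (b + (σ - 1) w) := by
  obtain ⟨x, hx, hx0, rfl⟩ := hU.exists_components hu
  suffices h : ∑ j, x j ∈ U i ⊔ (LinearMap.ker ((σ - 1) ^ (i : ℕ)) ⊔
      (LinearMap.ker ((σ - 1) ^ (i + 2 : ℕ))).map (σ - 1)) by
    obtain ⟨a, ha, c, hc, h1⟩ := Submodule.mem_sup.mp h
    obtain ⟨b, hb, _, ⟨w, hw, rfl⟩, rfl⟩ := Submodule.mem_sup.mp hc
    exact ⟨a, ha, b, w, hb, hw, h1.symm⟩
  refine Submodule.sum_mem _ fun j _ => ?_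
  rcases lt_trichotomy j i with hj | rfl | hj
  · refine Submodule.mem_sup_right (Submodule.mem_sup_left ?_)
    exact pow_apply_eq_zero_of_le ((hU.free j).pow_apply (hx j)) hj
  · exact Submodule.mem_sup_left (hx j)
  · refine Submodule.mem_sup_right (Submodule.mem_sup_right ?_)
    have hij : (i : ℕ) < j := hj
    obtain ⟨w, hw, hxw⟩ := (hU.free j).exists_eq_pow_apply (i := i + 1) (by omega) (hx j) (hx0 j)
    obtain ⟨d, hd⟩ : ∃ d, (j : ℕ) = i + 1 + d := ⟨j - i - 1, by omega⟩
    refine ⟨((σ - 1) ^ d) w, ?_, ?_⟩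
    · rw [SetLike.mem_coe, LinearMap.mem_ker, ← Module.End.mul_apply, ← pow_add]
      exact pow_apply_eq_zero_of_le ((hU.free j).pow_apply hw) (by omega)
    · rw [hxw, ← Module.End.mul_apply, ← pow_succ']
      congr 2
      omega

theorem IsOrthogonalDecomposition.hasNoBlock (hU : IsOrthogonalDecomposition f σ r U)
    {i : Fin r} (hi : U i = ⊥) : HasNoBlock (σ - 1) i := by
  intro u hu
  obtain ⟨a, ha, b, w, hb, hw, rfl⟩ := hU.exists_add_add i hu
  rw [hi, Submodule.mem_bot] at ha
  exact ⟨b, w, hb, hw, by rw [ha, zero_add]⟩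

theorem IsOrthogonalDecomposition.isAltAt_of_le (hU : IsOrthogonalDecomposition f σ r U)
    {n : ℕ} (hn : r ≤ n) : IsAltAt f (σ - 1) n := by
  intro u hu
  obtain ⟨x, hx, -, rfl⟩ := hU.exists_components hu
  have : ((σ - 1) ^ n) (∑ i, x i) = 0 := by
    rw [map_sum]
    refine Finset.sum_eq_zero fun i _ => ?_
    exact pow_apply_eq_zero_of_le ((hU.free i).pow_apply (hx i)) (by omega)
  rw [this, map_zero, LinearMap.zero_apply]

/-- Writing u = a + b + (σ - 1)w as in `exists_add_add`, all terms involving b or w vanish, so the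
value at u is that of its component a in U_i. Hence the alternating type of the induced form does
not depend on the decomposition. -/
theorem IsOrthogonalDecomposition.isAlt_inducedForm_iff (hU : IsOrthogonalDecomposition f σ r U)
    (hσ : IsAsymmetry f σ) (i : Fin r) :
    (inducedForm f σ hσ (i + 1) (U i) (hU.free i)).IsAlt ↔ IsAltAt f (σ - 1) i := by
  have hf := hσ.isTwisted_sub_one
  constructor
  · intro h u hu
    obtain ⟨a, ha, b, w, hb, hw, rfl⟩ := hU.exists_add_add i hu
    have ha0 := (hU.free i).pow_apply ha
    have h1 : f (((σ - 1) ^ (i : ℕ)) a) a = 0 := h ((subOneImage σ (U i)).mkQ ⟨a, ha⟩)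
    have h2 : f (((σ - 1) ^ (i : ℕ)) a) b = 0 := hf.apply_pow_left_eq_zero_of_pow (mul_one 1) hb a
    have h3 : f (((σ - 1) ^ (i : ℕ)) a) ((σ - 1) w) = 0 := by
      have := hf.apply_pow_pow_eq_zero (mul_one 1) ha0 (v := w) (j := i + 1) (fun l hl => by
        rw [pow_apply_eq_zero_of_le ha0 hl, map_zero, LinearMap.zero_apply]) 1 i le_rfl
      rwa [pow_one] at this
    have h4 := hf.apply_pow_left_eq_zero_of_pow (mul_one 1) hu w
    have h5 : ((σ - 1) ^ (i : ℕ)) (a + (b + (σ - 1) w)) =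
        ((σ - 1) ^ (i : ℕ)) a + ((σ - 1) ^ (i + 1 : ℕ)) w := by
      rw [map_add, map_add, hb, zero_add, ← Module.End.mul_apply, ← pow_succ]
    rw [h5, map_add f, LinearMap.add_apply, h4, map_add, map_add, h1, h2, h3]
    simp
  · intro h q
    obtain ⟨u, rfl⟩ := Submodule.mkQ_surjective _ q
    exact h u ((hU.free i).pow_apply u.2)

theorem IsOrthogonalDecomposition.isSymm_inducedForm (hU : IsOrthogonalDecomposition f σ r U)
    (hσ : IsAsymmetry f σ) {i : Fin r} (hi : Even (i : ℕ)) :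
    (inducedForm f σ hσ (i + 1) (U i) (hU.free i)).IsSymm := by
  refine ⟨fun p q => ?_⟩
  obtain ⟨u, rfl⟩ := Submodule.mkQ_surjective _ p
  obtain ⟨v, rfl⟩ := Submodule.mkQ_surjective _ q
  change f (((σ - 1) ^ (i : ℕ)) (u : V)) v = f (((σ - 1) ^ (i : ℕ)) (v : V)) u
  have hf := hσ.isTwisted_sub_one
  have hu := (hU.free i).pow_apply u.2
  have hv := (hU.free i).pow_apply v.2
  have h1 := hf.apply_pow_pow_top (mul_one 1) hu (v := v) (j := i) (fun l hl => by
    rw [pow_apply_eq_zero_of_le hu hl, map_zero, LinearMap.zero_apply]) i 0 (by omega)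
  rw [pow_zero, Module.End.one_apply, hi.neg_one_pow, one_mul] at h1
  rw [hf u, h1, ← Module.End.mul_apply, ← pow_succ', hv, map_zero]
  ring

/-- If u is in the radical, (σ - 1)^i u is orthogonal to U_i, hence to the whole generalized
eigenspace, and so is zero. Freeness then gives u ∈ (σ - 1)U_i. -/
theorem IsOrthogonalDecomposition.nondegenerate_inducedForm [FiniteDimensional F V]
    (hU : IsOrthogonalDecomposition f σ r U)
    (hσ : IsAsymmetry f σ) (hf : f.Nondegenerate) (i : Fin r) :
    (inducedForm f σ hσ (i + 1) (U i) (hU.free i)).Nondegenerate := by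
  refine nondegenerate_of_left fun p hp => ?_
  obtain ⟨u, rfl⟩ := Submodule.mkQ_surjective _ p
  have h0 : ∀ v ∈ U i, f (((σ - 1) ^ (i : ℕ)) (u : V)) v = 0 := fun v hv =>
    hp ((subOneImage σ (U i)).mkQ ⟨v, hv⟩)
  have hmem : ((σ - 1) ^ (i : ℕ)) (u : V) ∈ U i := by
    obtain ⟨h, -⟩ := hU.free i
    exact pow_mem_of_invariant (fun u hu => (U i).sub_mem (h u hu) hu) i u.2
  have hz : ((σ - 1) ^ (i : ℕ)) (u : V) = 0 := by
    have hle : iSup U ≤ LinearMap.ker (f (((σ - 1) ^ (i : ℕ)) (u : V))) := by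
      refine iSup_le fun j v hv => ?_
      by_cases hij : i = j
      · subst hij
        exact h0 v hv
      · exact hU.orthogonal i j hij _ hmem v hv
    refine hσ.eq_zero_of_orthogonal hf ?_ fun y hy => ?_
    · rw [← hU.iSup_eq]
      exact le_iSup U i hmem
    · rw [← hU.iSup_eq] at hy
      exact hle hy
  obtain ⟨w, hw, huw⟩ := (hU.free i).exists_eq_pow_apply (i := i) (by omega) u.2 hz
  rw [Nat.add_sub_cancel_left, pow_one] at huw
  rw [Submodule.mkQ_apply, Submodule.Quotient.mk_eq_zero]
  exact ⟨w, hw, huw.symm⟩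

/-- An equivalence of forms intertwines their asymmetries. -/
theorem IsAsymmetry.apply_comm_of_isometry (hσ : IsAsymmetry f σ) (hτ : IsAsymmetry g τ)
    (hg : g.Nondegenerate) (x : V ≃ₗ[F] V) (hx : ∀ u v, g (x u) (x v) = f u v) (u : V) :
    x (σ u) = τ (x u) := by
  rw [← sub_eq_zero]
  refine hg.2 _ fun w => ?_
  obtain ⟨v, rfl⟩ := x.surjective w
  rw [map_sub, ← hτ, hx, hx, hσ, hσ.apply_apply, sub_self]

/-- Forms with similar split asymmetries are equivalent, provided that, in characteristic two,
the forms on `ker (σ - 1)^(n+1)` and `ker (τ - 1)^(n+1)` are alternating simultaneously. -/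
theorem formsEquivalent_of_isConj [FiniteDimensional F V] (hF : IsQuadraticallyClosed F)
    (hf : f.Nondegenerate) (hg : g.Nondegenerate) (hσ : IsAsymmetry f σ) (hτ : IsAsymmetry g τ)
    (hsplit : (minpoly F σ).Splits) (c : V ≃ₗ[F] V) (hc : ∀ u, c (σ u) = τ (c u))
    (halt : (2 : F) = 0 → ∀ n, IsAltAt f (σ - 1) n ↔ IsAltAt g (τ - 1) n) :
    FormsEquivalent f g := by
  -- The pullback of g along the conjugating map is equivalent to g and has asymmetry σ.
  set g' : LinearMap.BilinForm F V := g.compl₁₂ (c : V →ₗ[F] V) (c : V →ₗ[F] V) with hg'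
  have hg'a : ∀ u v, g' u v = g (c u) (c v) := fun _ _ => rfl
  have hg'nd : g'.Nondegenerate := nondegenerate_of_left fun u hu => by
    have : c u = 0 := hg.1 _ fun w => by
      obtain ⟨v, rfl⟩ := c.surjective w
      exact hu v
    simpa using this
  have hσ' : IsAsymmetry g' σ := fun u v => by
    rw [hg'a, hg'a, hc, hτ]
  obtain ⟨x, hx⟩ := hσ.formsEquivalent hF hσ' hf hg'nd
    (sup_maxGenEigenspace_eq_top_of_splits hsplit) fun h2 n => by
      rw [halt h2 n]
      exact (FormsEquivalent.isAltAt_iff c (fun u v => (hg'a u v).symm)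
        (fun u => by simp [hc]) n).symm
  exact ⟨x.trans c, fun u v => hx u v⟩

end Invariants

/-! ### The two parts of the theorem. -/

theorem mainTheorem1 {F V : Type*} [Field F] [AddCommGroup V] [Module F V]
    [FiniteDimensional F V] (hF : IsQuadraticallyClosed F)
    (f g : LinearMap.BilinForm F V) (hf : f.Nondegenerate) (hg : g.Nondegenerate)
    (σ τ : V ≃ₗ[F] V)
    (hσ : IsAsymmetry f (σ : V →ₗ[F] V)) (hτ : IsAsymmetry g (τ : V →ₗ[F] V))
    (hfsplit : (minpoly F (σ : V →ₗ[F] V)).Splits)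
    (hgsplit : (minpoly F (τ : V →ₗ[F] V)).Splits)
    (hsim : IsConj σ τ) :
    ((ringChar F ≠ 2 ∨ (ringChar F = 2 ∧
        ∀ m : ℕ, Odd m → ¬ IsElementaryDivisor (σ : V →ₗ[F] V) ((X - 1) ^ m))) →
      FormsEquivalent f g) ∧
    (ringChar F = 2 →
      (∃ m : ℕ, Odd m ∧ IsElementaryDivisor (σ : V →ₗ[F] V) ((X - 1) ^ m)) →
      (∃ (r : ℕ) (U W : Fin r → Submodule F V),
        IsOrthogonalDecomposition f (σ : V →ₗ[F] V) r U ∧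
        IsOrthogonalDecomposition g (τ : V →ₗ[F] V) r W) ∧
      ∀ (r : ℕ) (U W : Fin r → Submodule F V)
        (hU : IsOrthogonalDecomposition f (σ : V →ₗ[F] V) r U)
        (hW : IsOrthogonalDecomposition g (τ : V →ₗ[F] V) r W),
        (∀ i : Fin r, Odd (i + 1 : ℕ) →
          (inducedForm f σ hσ (i + 1) (U i) (hU.free i)).IsSymm ∧
          (inducedForm f σ hσ (i + 1) (U i) (hU.free i)).Nondegenerate ∧
          (inducedForm g τ hτ (i + 1) (W i) (hW.free i)).IsSymm ∧
          (inducedForm g τ hτ (i + 1) (W i) (hW.free i)).Nondegenerate) ∧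
        (FormsEquivalent f g ↔
          ∀ i : Fin r, Odd (i + 1 : ℕ) → U i ≠ ⊥ →
            ((inducedForm f σ hσ (i + 1) (U i) (hU.free i)).IsAlt ∧
              (inducedForm g τ hτ (i + 1) (W i) (hW.free i)).IsAlt) ∨
            (¬ (inducedForm f σ hσ (i + 1) (U i) (hU.free i)).IsAlt ∧
              ¬ (inducedForm g τ hτ (i + 1) (W i) (hW.free i)).IsAlt))) := by
  obtain ⟨c, hc⟩ := isConj_iff.mp hsim
  have hc' : ∀ u, c ((σ : V →ₗ[F] V) u) = (τ : V →ₗ[F] V) (c u) := fun u => by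
    have h1 : c * σ = τ * c := by rw [← hc, inv_mul_cancel_right]
    exact LinearEquiv.congr_fun h1 u
  have hsub : ∀ u, c (((σ : V →ₗ[F] V) - 1) u) = ((τ : V →ₗ[F] V) - 1) (c u) := fun u => by
    rw [LinearMap.sub_apply, LinearMap.sub_apply, map_sub, hc']
    rfl
  have hequiv := formsEquivalent_of_isConj hF hf hg hσ hτ hfsplit c hc'
  have h2iff : ringChar F = 2 ↔ (2 : F) = 0 := by
    constructor
    · intro h
      have := ringChar.Nat.cast_ringChar (R := F)
      rw [h] at this
      exact_mod_cast this
    · intro h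
      have h1 : ringChar F ∣ 2 := ringChar.dvd (by exact_mod_cast h)
      exact ((Nat.dvd_prime Nat.prime_two).mp h1).resolve_left CharP.ringChar_ne_one
  have hodd : (2 : F) = 0 → ∀ n, Odd n →
      (IsAltAt f ((σ : V →ₗ[F] V) - 1) n ↔ IsAltAt g ((τ : V →ₗ[F] V) - 1) n) :=
    fun h2 n hn => iff_of_true
      (hσ.isTwisted_sub_one.isAltAt_of_isRigid (mul_one 1) (Or.inr ⟨h2, hn⟩))
      (hτ.isTwisted_sub_one.isAltAt_of_isRigid (mul_one 1) (Or.inr ⟨h2, hn⟩))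
  have hblock : ∀ n, HasNoBlock ((σ : V →ₗ[F] V) - 1) n →
      (IsAltAt f ((σ : V →ₗ[F] V) - 1) n ↔ IsAltAt g ((τ : V →ₗ[F] V) - 1) n) :=
    fun n hn => iff_of_true (hn.isAltAt hσ.isTwisted_sub_one (mul_one 1))
      ((hn.of_conj c hsub).isAltAt hτ.isTwisted_sub_one (mul_one 1))
  refine ⟨?_, fun h2 _ => ⟨?_, ?_⟩⟩
  · rintro (h | ⟨-, h⟩)
    · exact hequiv fun h2 => absurd (h2iff.mpr h2) h
    · refine hequiv fun h2 n => ?_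
      rcases Nat.even_or_odd n with hn | hn
      · exact hblock n (hasNoBlock_of_not_isElementaryDivisor (h (n + 1) hn.add_one))
      · exact hodd h2 n hn
  · obtain ⟨U, hU⟩ := hσ.exists_isOrthogonalDecomposition hf le_rfl
    obtain ⟨W, hW⟩ := hτ.exists_isOrthogonalDecomposition hg le_rfl
    exact ⟨_, U, W, hU, hW⟩
  · intro r U W hU hW
    have heven : ∀ i : Fin r, Odd (i + 1 : ℕ) → Even (i : ℕ) := fun i hi => by
      rwa [Nat.odd_add_one, Nat.not_odd_iff_even] at hi
    refine ⟨fun i hi => ⟨hU.isSymm_inducedForm hσ (heven i hi),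
      hU.nondegenerate_inducedForm hσ hf i, hW.isSymm_inducedForm hτ (heven i hi),
      hW.nondegenerate_inducedForm hτ hg i⟩, ?_, ?_⟩
    -- An equivalence intertwines the asymmetries, so it preserves the alternating type in each
    -- degree.
    · rintro ⟨x, hx⟩ i - -
      rw [hU.isAlt_inducedForm_iff hσ, hW.isAlt_inducedForm_iff hτ]
      have hiff := FormsEquivalent.isAltAt_iff x hx (N := (σ : V →ₗ[F] V) - 1)
        (M := (τ : V →ₗ[F] V) - 1) (fun u => by
          rw [LinearMap.sub_apply, LinearMap.sub_apply, map_sub,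
            hσ.apply_comm_of_isometry hτ hg x hx]
          rfl) i
      tauto
    · intro h
      refine hequiv fun h2 n => ?_
      rcases Nat.even_or_odd n with hn | hn
      swap
      · exact hodd h2 n hn
      rcases Nat.lt_or_ge n r with hlt | hge
      · by_cases hbot : U ⟨n, hlt⟩ = ⊥
        · exact hblock n (hU.hasNoBlock hbot)
        · have h3 := h ⟨n, hlt⟩ hn.add_one hbot
          rw [hU.isAlt_inducedForm_iff hσ, hW.isAlt_inducedForm_iff hτ] at h3
          change (IsAltAt f _ n ∧ IsAltAt g _ n) ∨ (¬ IsAltAt f _ n ∧ ¬ IsAltAt g _ n) at h3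
          tauto
      · exact iff_of_true (hU.isAltAt_of_le hge) (hW.isAltAt_of_le hge)
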